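/- Let $N\ge 1$ and $\delta\ge 2$ be integers and $\lambda>0$ a real number. Let $\mathcal L$ be the set of Laguerre entire functions, i.e. of the functions $f:\mathbb C\to\mathbb C$ of the form $$f(z)=Cz^{m}e^{\alpha z}\prod_{j=1}^{\infty}(1+\gamma_j z),\qquad C\in\mathbb C,\ m\in\mathbb N_0,\ \alpha\ge 0,\ \gamma_j\ge\gamma_{j+1}\ge 0,\ \sum_{j}\gamma_j<\infty ,$$ and let $\mathcal L^{+}=\{f\in\mathcal L: f(0)>0\}$. For $g\in\mathcal L^{+}$ with exponent $\alpha$ put $I(g)=[0,(\delta^{\lambda}-1)/\alpha]$ if $\alpha>0$ and $I(g)=[0,\infty)$ if $\alpha=0$. Let $\mathcal L^{+}(\mathbb R^N)$ be the set of functions $F:\mathbb R^N\to\mathbb C$ of the form $F(x)=f((x,x))$ with $f\in\mathcal L^{+}$, where $(\cdot,\cdot)$ is the scalar product of $\mathbb R^N$. For an $O(N)$-invariant real-analytic function $F:\mathbb R^N\to\mathbb C$ the function $\bigl(\Delta+\frac{d}{(x,x)}(x,\nabla)\bigr)F$ is defined at $x=0$ by continuous extension. Let $d\ge -N$ be real,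 $G\in\mathcal L^{+}(\mathbb R^N)$ with $G(x)=g((x,x))$, $g\in\mathcal L^{+}$, and let $\tau$ be such that $4\tau\in I(g)$. Consider the recursive sequence of Cauchy problems $$\frac{\partial F_n(t,x)}{\partial t}=\tau\Bigl(\Delta+\frac{d}{(x,x)}(x,\nabla)\Bigr)F_n(t,x),\qquad t\in[0,1],\ x\in\mathbb R^N,$$ $$F_n(0,x)=\bigl[F_{n-1}(1,x\,\delta^{-(1+\lambda)/2})\bigr]^{\delta},\quad n\in\mathbb N,\qquad F_0(1,x)=G(x).$$ A solution of one of these Cauchy problems is a continuous function $F_n$ on $[0,1]\times\mathbb R^N$ such that $F_n(t,\cdot)$ is real-analytic and $O(N)$-invariant for every $t\in[0,1]$, such that $|F_n(t,x)|\le Ke^{b|x|^2}$ on $[0,1]\times\mathbb R^N$ for some constants $K,b$, and such that the equation holds at every $(t,x)\in[0,1]\times\mathbb R^N$ (with one-sided time derivatives at $t=0,1$) together with the initial condition. Then for every $n\in\mathbb N$ the first $n$ of these problems have a solution $F_1,\dots,F_n$, this solution is unique, and $F_k(t,\cdot)\in\mathcal L^{+}(\mathbb R^N)$ for all $1\le k\le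 n$ and $t\in[0,1]$. -/

import Mathlib

open Set Filter Topology

noncomputable section

namespace LaguerreEvolution

/-- `f (z) = C z ^ m exp (α z) ∏_j (1 + γ_j z)` with `C ∈ ℂ`, `m ∈ ℕ`, `α ≥ 0`, and a summable
sequence `γ_0 ≥ γ_1 ≥ … ≥ 0`. -/
structure IsLaguerreRep (f : ℂ → ℂ) (C : ℂ) (m : ℕ) (α : ℝ) (γ : ℕ → ℝ) : Prop where
  alpha_nonneg : 0 ≤ α
  gamma_antitone : Antitone γ
  gamma_nonneg : ∀ j, 0 ≤ γ j
  gamma_summable : Summable γ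
  eq : ∀ z : ℂ, f z = C * z ^ m * Complex.exp ((α : ℂ) * z) * ∏' j, (1 + (γ j : ℂ) * z)

/-- The Laguerre entire functions `𝓛`. -/
def laguerre : Set (ℂ → ℂ) :=
  {f | ∃ (C : ℂ) (m : ℕ) (α : ℝ) (γ : ℕ → ℝ), IsLaguerreRep f C m α γ}

/-- `𝓛⁺`: the Laguerre entire functions `f` with `f 0` real and positive. -/
def laguerrePos : Set (ℂ → ℂ) :=
  {f | f ∈ laguerre ∧ 0 < (f 0).re ∧ (f 0).im = 0}

/-- The interval `I (g)`: with `α` the exponent of `g` it is `[0, (δ ^ lam - 1) / α]` if `α > 0`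
and `[0, ∞)` if `α = 0`. (A nonzero `g` determines `α`.) -/
def paramInterval (δ : ℕ) (lam : ℝ) (g : ℂ → ℂ) : Set ℝ :=
  {τ | ∃ (C : ℂ) (m : ℕ) (α : ℝ) (γ : ℕ → ℝ), IsLaguerreRep g C m α γ ∧
    0 ≤ τ ∧ (0 < α → τ ≤ ((δ : ℝ) ^ lam - 1) / α)}

/-- `ℝ^N` with its Euclidean structure. -/
abbrev Space (N : ℕ) : Type := EuclideanSpace ℝ (Fin N)

/-- The real-analytic functions `ℝ^N → ℂ` that are invariant under `O(N)`. -/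
def isotAnalytic (N : ℕ) : Set (Space N → ℂ) :=
  {F | AnalyticOnNhd ℝ F univ ∧ ∀ (U : Space N ≃ₗᵢ[ℝ] Space N) (x : Space N), F (U x) = F x}

/-- For a set `X` of functions on `ℂ`, the set `X (ℝ^N)` of the isotropic analytic functions
`F (x) = f ((x, x))` with `f ∈ X`. -/
def radial (N : ℕ) (X : Set (ℂ → ℂ)) : Set (Space N → ℂ) :=
  {F | F ∈ isotAnalytic N ∧ ∃ f ∈ X, ∀ x : Space N, F x = f ((inner ℝ x x : ℝ) : ℂ)}

/-- `Δ F (x) + d / (x, x) * (x, ∇) F (x)`, meaningful for `x ≠ 0`. -/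
def radialOpAway {N : ℕ} (d : ℝ) (F : Space N → ℂ) (x : Space N) : ℂ :=
  Laplacian.laplacian F x + ((d / inner ℝ x x : ℝ) : ℂ) * fderiv ℝ F x x

open Classical in
/-- The operator `Δ + d / (x, x) * (x, ∇)`. For an isotropic analytic function the formula has a
removable singularity at the origin; the value there is its limit. -/
def radialOp {N : ℕ} (d : ℝ) (F : Space N → ℂ) (x : Space N) : ℂ :=
  if x = 0 then limUnder (𝓝[≠] (0 : Space N)) (radialOpAway d F) else radialOpAway d F x

/-- `F (t, x)`, `t ∈ [0, 1]`, is a solution of `∂F/∂t = τ (Δ + d / (x, x) * (x, ∇)) F` with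
`F (0, ·) = H`: a continuous function, isotropic and analytic in `x`, that is bounded by
`K exp (b |x|²)` for some `K` and `b` and satisfies the equation everywhere (with one-sided time
derivatives at the ends of the interval). -/
structure IsCauchySolution {N : ℕ} (τ d : ℝ) (H : Space N → ℂ) (F : ℝ → Space N → ℂ) :
    Prop where
  continuousOn : ContinuousOn (fun p : ℝ × Space N => F p.1 p.2) (Icc (0 : ℝ) 1 ×ˢ univ)
  isot : ∀ t ∈ Icc (0 : ℝ) 1, F t ∈ isotAnalytic N
  growth : ∃ K b : ℝ, ∀ t ∈ Icc (0 : ℝ) 1, ∀ x : Space N, ‖F t x‖ ≤ K * Real.exp (b * ‖x‖ ^ 2)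
  equation : ∀ t ∈ Icc (0 : ℝ) 1, ∀ x : Space N,
    HasDerivWithinAt (fun s => F s x) ((τ : ℂ) * radialOp d (F t) x) (Icc (0 : ℝ) 1) t
  initial : ∀ x : Space N, F 0 x = H x

/-- The functions `F 1, …, F n` are solutions of the first `n` Cauchy problems of the recursion
started at `F_0 (1, x) = G (x)`. -/
def IsSolutionUpTo {N : ℕ} (δ : ℕ) (lam τ d : ℝ) (G : Space N → ℂ) (n : ℕ)
    (F : ℕ → ℝ → Space N → ℂ) : Prop :=
  (∀ x, F 0 1 x = G x) ∧
    ∀ k ∈ Icc 1 n,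
      IsCauchySolution τ d (fun x => (F (k - 1) 1 ((δ : ℝ) ^ (-(1 + lam) / 2) • x)) ^ δ) (F k)

end LaguerreEvolution

end

/-!
With `z = (x, x)` and `θ = (N + d) / 2 ≥ 0` the operator `Δ + d / (x, x) (x, ∇)` acts on
`f ((x, x))` as `4 (z f'' + θ f') = 4 (θ + z D) D f`, so that each Cauchy problem is solved by
`f_t = exp (4 τ t (θ + z D) D) f_0`, provided that this makes sense and stays in `𝓛⁺`.

*Preservation of `𝓛⁺`.* Functions of `𝓛⁺` are handled as power series which are limits of
polynomials with positive value at the origin, nonnegative coefficients and real zeros, the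
coefficients being dominated by those of `K exp (b z)` for every `b` larger than the type `σ`
(`IsLaguerreSeq`). A function of `𝓛⁺` with exponent `α` is such a limit with `σ = α`
(`exists_isLaguerreSeq_of_rep`); conversely such a limit, if positive at the origin, is in `𝓛⁺`, by
compactness of the sequences of reciprocal zeros (`IsLaguerreSeq.mem_laguerrePos`). A polynomial `p`
of this kind is mapped to one of this kind by `1 + a (θ + z D) D`, because for nonconstant `p` and
`Im z > 0` the function `p / p' + a (θ + z p'' / p')` has positive imaginary part
(`IsLaguerrePoly.add_smul_bessel`). As `exp (a (θ + z D) D)` is the limit of the powers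
`(1 + (a / n) (θ + z D) D) ^ n`, it maps limits of type `σ` with `a σ < 1` to limits of type
`σ / (1 - a σ)` (`IsLaguerreSeq.flow`); this is dominated convergence, the majorant being a binomial
series.

*The recursion.* Dilation by `δ ^ (-(1 + lam))` and the power `δ` multiply the type by `δ ^ (-lam)`.
If `4 τ α ≤ δ ^ lam - 1`, then `β = δ ^ (-lam) α` satisfies `4 τ β ≤ 1 - δ ^ (-lam) < 1` and
`β / (1 - 4 τ β) ≤ α`, so the type never exceeds `α` and every step is possible
(`exists_recursion_step`).

*Uniqueness.* The profile `h (r) = F (r e)`, `|e| = 1`, of an isotropic solution is even and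
satisfies `∂_t h = τ (h'' + ((N - 1 + d) / r) h')`, with `τ (N + d) h'' (0)` on the right at
`r = 0`. As `N + d ≥ 0`, the right side is nonpositive at a maximum, and the difference of two
solutions is compared with the barrier `ε exp (c (t) r ^ 2 + k t)` on short time intervals
(`nonpos_of_short_time`).
-/

namespace LaguerreEvolution

/-! ### Polynomials with negative zeros and the operator `(θ + z D) D` -/

section Polynomials

open Polynomial

/-- The polynomials of the class `𝓛⁺`: real polynomials with nonnegative coefficients, positive at
the origin, without zeros in the open upper half plane. By conjugation all zeros are then real, and
they are negative. -/
structure IsLaguerrePoly (p : ℝ[X]) : Prop where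
  coeff_nonneg : ∀ k, 0 ≤ p.coeff k
  coeff_zero_pos : 0 < p.coeff 0
  aeval_ne_zero : ∀ z : ℂ, 0 < z.im → aeval z p ≠ 0

theorem aeval_ofReal_eq_eval (p : ℝ[X]) (x : ℝ) : aeval (x : ℂ) p = ((p.eval x : ℝ) : ℂ) := by
  rw [← Complex.coe_algebraMap, aeval_algebraMap_apply, coe_aeval_eq_eval]

theorem eval_pos_of_coeff_nonneg {p : ℝ[X]} (hp : ∀ k, 0 ≤ p.coeff k) (h0 : p ≠ 0) {x : ℝ}
    (hx : 0 < x) : 0 < p.eval x := by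
  rw [eval_eq_sum_range]
  refine Finset.sum_pos' (fun i _ => mul_nonneg (hp i) (pow_nonneg hx.le i))
    ⟨p.natDegree, by simp, mul_pos ?_ (pow_pos hx _)⟩
  exact lt_of_le_of_ne (hp _) (by simpa using (leadingCoeff_ne_zero.mpr h0).symm)

/-- A real polynomial with nonnegative coefficients and no zeros in the upper half plane has
only real nonpositive zeros. -/
theorem root_real_nonpos {p : ℝ[X]} (hp : ∀ k, 0 ≤ p.coeff k) (h0 : p ≠ 0)
    (hz : ∀ z : ℂ, 0 < z.im → aeval z p ≠ 0) {r : ℂ} (hr : aeval r p = 0) :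
    r.im = 0 ∧ r.re ≤ 0 := by
  have him : r.im = 0 := by
    rcases lt_trichotomy r.im 0 with h | h | h
    · refine absurd ?_ (hz ((starRingEnd ℂ) r) (by simpa using h))
      rw [aeval_conj, hr, map_zero]
    · exact h
    · exact absurd hr (hz r h)
  refine ⟨him, not_lt.mp fun hre => ?_⟩
  have hrr : r = (r.re : ℂ) := Complex.ext rfl (by simpa using him)
  rw [hrr, aeval_ofReal_eq_eval] at hr
  exact (eval_pos_of_coeff_nonneg hp h0 hre).ne' (by exact_mod_cast hr)

theorem im_multiset_sum (s : Multiset ℂ) : s.sum.im = (s.map Complex.im).sum :=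
  map_multiset_sum Complex.imAddGroupHom s

theorem aeval_derivative_div_aeval {p : ℝ[X]} {z : ℂ} (hz : aeval z p ≠ 0) :
    aeval z (derivative p) / aeval z p
      = ((p.aroots ℂ).map (fun r => 1 / (z - r))).sum := by
  have := (IsAlgClosed.splits (p.map (algebraMap ℝ ℂ))).eval_derivative_div_eval_of_ne_zero
    (x := z) (by rwa [eval_map_algebraMap])
  rwa [derivative_map, eval_map_algebraMap, eval_map_algebraMap] at this

/-- The logarithmic derivative of a nonconstant polynomial with real zeros maps the upper half
plane to the lower one. -/
theorem im_logDeriv_neg {p : ℝ[X]} (hr : ∀ r ∈ p.aroots ℂ, r.im = 0) (hd : 0 < p.natDegree)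
    {z : ℂ} (hz : 0 < z.im) (hpz : aeval z p ≠ 0) :
    (aeval z (derivative p) / aeval z p).im < 0 := by
  rw [aeval_derivative_div_aeval hpz, im_multiset_sum, Multiset.map_map]
  have hterm : ∀ r ∈ p.aroots ℂ, (Complex.im ∘ fun r => 1 / (z - r)) r < 0 := by
    intro r hrm
    have hzr : z - r ≠ 0 := fun h => by
      have := congrArg Complex.im h
      simp [hr r hrm] at this
      exact hz.ne' this
    simp only [Function.comp, one_div, Complex.inv_im, Complex.sub_im, hr r hrm, sub_zero]
    exact div_neg_of_neg_of_pos (by linarith) (Complex.normSq_pos.mpr hzr)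
  have hne : p.aroots ℂ ≠ 0 := by
    intro h
    have h1 := (IsAlgClosed.splits (p.map (algebraMap ℝ ℂ))).natDegree_eq_card_roots
    rw [natDegree_map] at h1
    rw [aroots] at h
    rw [h] at h1
    simp at h1
    omega
  exact Multiset.sum_lt_sum_of_nonempty (g := fun _ => (0 : ℝ)) hne hterm |>.trans_eq (by simp)

/-- For zeros `r ≤ 0` each term of `z p' / p`, being `z / (z - r) = 1 + r / (z - r)`, has
nonnegative imaginary part on the upper half plane. -/
theorem im_mul_logDeriv_nonneg {p : ℝ[X]} (hr : ∀ r ∈ p.aroots ℂ, r.im = 0 ∧ r.re ≤ 0)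
    {z : ℂ} (hz : 0 < z.im) (hpz : aeval z p ≠ 0) :
    0 ≤ (z * (aeval z (derivative p) / aeval z p)).im := by
  rw [aeval_derivative_div_aeval hpz, ← Multiset.sum_map_mul_left, im_multiset_sum,
    Multiset.map_map]
  refine Multiset.sum_nonneg ?_
  intro x hx
  obtain ⟨r, hrm, rfl⟩ := Multiset.mem_map.mp hx
  obtain ⟨h1, h2⟩ := hr r hrm
  have hzr : z - r ≠ 0 := fun h => by
    have := congrArg Complex.im h
    simp [h1] at this
    exact hz.ne' this
  have hn := Complex.normSq_pos.mpr hzr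
  simp only [Function.comp, one_div, Complex.mul_im, Complex.inv_im, Complex.inv_re,
    Complex.sub_im, Complex.sub_re, h1, sub_zero]
  rw [show z.re * (-z.im / Complex.normSq (z - r)) + z.im * ((z.re - r.re) / Complex.normSq (z - r))
    = (z.im * (-r.re)) / Complex.normSq (z - r) by field_simp; ring]
  exact div_nonneg (mul_nonneg hz.le (by linarith)) hn.le

/-- The operator `(θ + z D) D` on real polynomials. -/
noncomputable def besselPoly (θ : ℝ) : Module.End ℝ ℝ[X] :=
  θ • derivative + (LinearMap.mulLeft ℝ X).comp (derivative.comp derivative)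

theorem besselPoly_apply (θ : ℝ) (p : ℝ[X]) :
    besselPoly θ p = θ • derivative p + X * derivative (derivative p) := rfl

theorem coeff_besselPoly (θ : ℝ) (p : ℝ[X]) (m : ℕ) :
    (besselPoly θ p).coeff m = (m + 1) * (m + θ) * p.coeff (m + 1) := by
  rw [besselPoly_apply, coeff_add, coeff_smul, coeff_derivative, smul_eq_mul]
  cases m with
  | zero => simp
  | succ m => rw [coeff_X_mul, coeff_derivative, coeff_derivative]; push_cast; ring

/-- `1 + a (θ + z D) D` preserves the class: for `Im z > 0` the quotient of the image of `p` by
`p'` is `p / p' + a (θ + z p'' / p')`, whose imaginary part is positive. -/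
theorem IsLaguerrePoly.add_smul_bessel {p : ℝ[X]} (hp : IsLaguerrePoly p) {θ a : ℝ} (hθ : 0 ≤ θ)
    (ha : 0 ≤ a) : IsLaguerrePoly (p + a • besselPoly θ p) := by
  have hc : ∀ k, p.coeff k ≤ (p + a • besselPoly θ p).coeff k := fun k => by
    rw [coeff_add, coeff_smul, coeff_besselPoly, smul_eq_mul]
    have := hp.coeff_nonneg (k + 1)
    have : 0 ≤ a * ((k + 1) * (k + θ) * p.coeff (k + 1)) := by positivity
    linarith
  refine ⟨fun k => (hp.coeff_nonneg k).trans (hc k), hp.coeff_zero_pos.trans_le (hc 0), ?_⟩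
  intro z hz
  have hp0 : p ≠ 0 := fun h => by simpa [h] using hp.coeff_zero_pos
  rcases Nat.eq_zero_or_pos p.natDegree with hd | hd
  · have : besselPoly θ p = 0 := by
      rw [besselPoly_apply, derivative_of_natDegree_zero hd]; simp
    rw [this]
    simpa using hp.aeval_ne_zero z hz
  have hroots : ∀ r ∈ p.aroots ℂ, r.im = 0 := fun r hr =>
    (root_real_nonpos hp.coeff_nonneg hp0 hp.aeval_ne_zero (mem_aroots.mp hr).2).1
  have hL : ∀ w : ℂ, 0 < w.im → (aeval w (derivative p) / aeval w p).im < 0 := fun w hw =>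
    im_logDeriv_neg hroots hd hw (hp.aeval_ne_zero w hw)
  have hq : ∀ w : ℂ, 0 < w.im → aeval w (derivative p) ≠ 0 := fun w hw h => by
    have := hL w hw
    simp [h] at this
  have hq0 : derivative p ≠ 0 := fun h => hd.ne' (derivative_eq_zero.mp h)
  have hqc : ∀ k, 0 ≤ (derivative p).coeff k := fun k => by
    rw [coeff_derivative]
    exact mul_nonneg (hp.coeff_nonneg _) (by positivity)
  -- `p'` has the properties needed of `p` itself, so its zeros are real and nonpositive too
  have h2 := im_mul_logDeriv_nonneg (p := derivative p)
    (fun r hr => root_real_nonpos hqc hq0 hq (mem_aroots.mp hr).2) hz (hq z hz)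
  have h1 : 0 < (aeval z p / aeval z (derivative p)).im := by
    rw [← inv_div, Complex.inv_im]
    refine div_pos (by linarith [hL z hz]) (Complex.normSq_pos.mpr ?_)
    exact div_ne_zero (hq z hz) (hp.aeval_ne_zero z hz)
  intro h0
  have h3 : aeval z p / aeval z (derivative p) + (a : ℂ) * ((θ : ℂ) +
      z * (aeval z (derivative (derivative p)) / aeval z (derivative p))) = 0 := by
    rw [besselPoly_apply] at h0
    simp only [map_add, map_smul, map_mul, aeval_X, Complex.real_smul] at h0
    have hqz := hq z hz
    field_simp
    linear_combination h0
  have h4 := congrArg Complex.im h3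
  rw [Complex.add_im, Complex.im_ofReal_mul, Complex.add_im, Complex.ofReal_im, zero_add,
    Complex.zero_im] at h4
  have := mul_nonneg ha h2
  linarith

theorem IsLaguerrePoly.pow_bessel {p : ℝ[X]} (hp : IsLaguerrePoly p) {θ a : ℝ} (hθ : 0 ≤ θ)
    (ha : 0 ≤ a) (n : ℕ) : IsLaguerrePoly (((1 + a • besselPoly θ) ^ n) p) := by
  induction n with
  | zero => simpa using hp
  | succ n ih => rw [pow_succ']; exact ih.add_smul_bessel hθ ha

theorem IsLaguerrePoly.mul {p q : ℝ[X]} (hp : IsLaguerrePoly p) (hq : IsLaguerrePoly q) :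
    IsLaguerrePoly (p * q) where
  coeff_nonneg k := by
    rw [coeff_mul]
    exact Finset.sum_nonneg fun i _ => mul_nonneg (hp.coeff_nonneg _) (hq.coeff_nonneg _)
  coeff_zero_pos := by
    rw [mul_coeff_zero]
    exact mul_pos hp.coeff_zero_pos hq.coeff_zero_pos
  aeval_ne_zero z hz := by
    rw [map_mul]
    exact mul_ne_zero (hp.aeval_ne_zero z hz) (hq.aeval_ne_zero z hz)

theorem isLaguerrePoly_C {a : ℝ} (ha : 0 < a) : IsLaguerrePoly (C a) where
  coeff_nonneg k := by
    rw [coeff_C]; split_ifs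
    exacts [ha.le, le_rfl]
  coeff_zero_pos := by simpa using ha
  aeval_ne_zero z hz := by simpa using ha.ne'

theorem isLaguerrePoly_one_add {a : ℝ} (ha : 0 ≤ a) : IsLaguerrePoly (1 + C a * X) where
  coeff_nonneg k := by
    rw [coeff_add, coeff_one, coeff_C_mul, coeff_X]
    split_ifs <;> simp <;> linarith
  coeff_zero_pos := by simp
  aeval_ne_zero z hz h := by
    simp only [map_add, map_one, map_mul, aeval_C, aeval_X, Complex.coe_algebraMap] at h
    have h1 := congrArg Complex.im h
    have h2 := congrArg Complex.re h
    simp at h1 h2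
    rcases h1 with h1 | h1
    · simp [h1] at h2
    · exact hz.ne' h1

theorem IsLaguerrePoly.pow {p : ℝ[X]} (hp : IsLaguerrePoly p) (n : ℕ) : IsLaguerrePoly (p ^ n) := by
  induction n with
  | zero => simpa using isLaguerrePoly_C one_pos
  | succ n ih => rw [pow_succ]; exact ih.mul hp

theorem isLaguerrePoly_prod {ι : Type*} (s : Finset ι) (p : ι → ℝ[X])
    (hp : ∀ i ∈ s, IsLaguerrePoly (p i)) : IsLaguerrePoly (∏ i ∈ s, p i) :=
  Finset.prod_induction p IsLaguerrePoly (fun _ _ => IsLaguerrePoly.mul)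
    (by simpa using isLaguerrePoly_C one_pos) hp

theorem IsLaguerrePoly.comp_mul {p : ℝ[X]} (hp : IsLaguerrePoly p) {c : ℝ} (hc : 0 < c) :
    IsLaguerrePoly (p.comp (C c * X)) where
  coeff_nonneg k := by
    rw [comp_C_mul_X_coeff]
    exact mul_nonneg (hp.coeff_nonneg k) (by positivity)
  coeff_zero_pos := by
    rw [comp_C_mul_X_coeff]
    simpa using hp.coeff_zero_pos
  aeval_ne_zero z hz := by
    rw [aeval_comp]
    refine hp.aeval_ne_zero _ ?_
    simpa using mul_pos hc hz

/-- A polynomial of the class is `p (0) ∏ (1 + γ_j z)`, the `γ_j = -1 / r_j` coming from its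
zeros; they are listed in decreasing order and continued by zeros. -/
theorem IsLaguerrePoly.exists_factorization {p : ℝ[X]} (hp : IsLaguerrePoly p) :
    ∃ (M : ℕ) (γ : ℕ → ℝ), Antitone γ ∧ (∀ j, 0 ≤ γ j) ∧ (∀ j, M ≤ j → γ j = 0) ∧
      ∀ z : ℂ, aeval z p = (p.coeff 0 : ℂ) * ∏ j ∈ Finset.range M, (1 + (γ j : ℂ) * z) := by
  have hp0 : p ≠ 0 := fun h => by simpa [h] using hp.coeff_zero_pos
  have hroot : ∀ r ∈ p.aroots ℂ, r = (r.re : ℂ) ∧ r.re < 0 := fun r hr => by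
    have hr0 := (mem_aroots.mp hr).2
    obtain ⟨h1, h2⟩ := root_real_nonpos hp.coeff_nonneg hp0 hp.aeval_ne_zero hr0
    have hrr : r = (r.re : ℂ) := Complex.ext rfl (by simpa using h1)
    refine ⟨hrr, lt_of_le_of_ne h2 fun h => ?_⟩
    rw [hrr, h, Complex.ofReal_zero, ← coeff_zero_eq_aeval_zero'] at hr0
    exact hp.coeff_zero_pos.ne' (by simpa using hr0)
  set s : Multiset ℝ := (p.aroots ℂ).map fun r => -1 / r.re with hs
  set l : List ℝ := s.sort (· ≥ ·) with hl
  have hls : (l : Multiset ℝ) = s := Multiset.sort_eq _ _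
  have hpos : ∀ x ∈ l, 0 ≤ x := fun x hx => by
    have : x ∈ s := by rw [← hls]; exact hx
    obtain ⟨r, hr, rfl⟩ := Multiset.mem_map.mp this
    exact div_nonneg_of_nonpos (by norm_num) (hroot r hr).2.le
  have hnn : ∀ j, 0 ≤ l.getD j 0 := fun j => by
    rcases lt_or_ge j l.length with h | h
    · rw [List.getD_eq_getElem _ _ h]; exact hpos _ (List.getElem_mem h)
    · rw [List.getD_eq_default _ _ h]
  refine ⟨l.length, fun j => l.getD j 0, ?_, hnn, fun j hj => List.getD_eq_default _ _ hj, ?_⟩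
  · intro i j hij
    rcases lt_or_ge j l.length with h | h
    · have hi := hij.trans_lt h
      simp only [List.getD_eq_getElem _ _ h, List.getD_eq_getElem _ _ hi]
      rcases hij.eq_or_lt with rfl | hlt
      · exact le_rfl
      · exact List.pairwise_iff_getElem.mp (Multiset.pairwise_sort s (· ≥ ·)) i j hi h hlt
    · simp only [List.getD_eq_default _ _ h]
      exact hnn i
  · intro z
    have hprod : ∀ w : ℂ, aeval w p = (p.leadingCoeff : ℂ) *
        ((p.aroots ℂ).map fun r => w - r).prod := fun w =>
      (IsAlgClosed.splits (p.map (algebraMap ℝ ℂ))).aeval_eq_prod_aroots w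
    have h1 : ∏ j ∈ Finset.range l.length, (1 + ((l.getD j 0 : ℝ) : ℂ) * z)
        = ((p.aroots ℂ).map fun r => 1 + ((-1 / r.re : ℝ) : ℂ) * z).prod := by
      have h2 : (s.map fun x : ℝ => 1 + (x : ℂ) * z).prod
          = ((p.aroots ℂ).map fun r => 1 + ((-1 / r.re : ℝ) : ℂ) * z).prod := by
        rw [hs, Multiset.map_map]; rfl
      rw [← h2, ← hls, Multiset.map_coe, Multiset.prod_coe, ← Fin.prod_univ_getElem,
        Finset.prod_range]
      refine Fintype.prod_equiv (finCongr (by simp)) _ _ fun i => ?_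
      simp
    have h0 : (p.coeff 0 : ℂ) = (p.leadingCoeff : ℂ) * ((p.aroots ℂ).map fun r => -r).prod := by
      simpa using (coeff_zero_eq_aeval_zero' (A := ℂ) p).trans (hprod 0)
    rw [h1, h0, hprod z, mul_assoc, ← Multiset.prod_map_mul]
    congr 2
    refine Multiset.map_congr rfl fun r hr => ?_
    obtain ⟨h3, h4⟩ := hroot r hr
    have h5 : (r.re : ℂ) ≠ 0 := by exact_mod_cast h4.ne
    rw [h3]
    push_cast
    simp only [Complex.ofReal_re]
    field_simp
    ring

end Polynomials

/-! ### Power series that are limits of such polynomials -/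

section Sequences

open Polynomial

/-- The sum of the power series with real coefficients `c` (`0` where the series diverges). -/
noncomputable def powerSum (c : ℕ → ℝ) (z : ℂ) : ℂ := ∑' k, (c k : ℂ) * z ^ k

/-- The coefficients of `p` are nonnegative and dominated by those of `K exp (b z)`. -/
structure IsExpBounded (p : ℝ[X]) (K b : ℝ) : Prop where
  const_nonneg : 0 ≤ K
  rate_nonneg : 0 ≤ b
  coeff_nonneg : ∀ k, 0 ≤ p.coeff k
  coeff_le : ∀ k, p.coeff k ≤ K * (b ^ k / k.factorial)

theorem IsExpBounded.mul {p q : ℝ[X]} {K b K' b' : ℝ} (hp : IsExpBounded p K b)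
    (hq : IsExpBounded q K' b') : IsExpBounded (p * q) (K * K') (b + b') where
  const_nonneg := mul_nonneg hp.const_nonneg hq.const_nonneg
  rate_nonneg := add_nonneg hp.rate_nonneg hq.rate_nonneg
  coeff_nonneg k := by
    rw [coeff_mul]
    exact Finset.sum_nonneg fun i _ => mul_nonneg (hp.coeff_nonneg _) (hq.coeff_nonneg _)
  coeff_le k := by
    rw [coeff_mul, (Commute.all b b').add_pow', Finset.sum_div, Finset.mul_sum]
    refine Finset.sum_le_sum fun x hx => ?_
    have hk : x.1 + x.2 = k := Finset.HasAntidiagonal.mem_antidiagonal.mp hx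
    calc p.coeff x.1 * q.coeff x.2
        ≤ (K * (b ^ x.1 / x.1.factorial)) * (K' * (b' ^ x.2 / x.2.factorial)) :=
          mul_le_mul (hp.coeff_le _) (hq.coeff_le _) (hq.coeff_nonneg _)
            (mul_nonneg hp.const_nonneg
              (div_nonneg (pow_nonneg hp.rate_nonneg _) (Nat.cast_nonneg _)))
      _ = _ := by
          have h := Nat.choose_mul_factorial_mul_factorial (show x.1 ≤ k by omega)
          rw [show k - x.1 = x.2 by omega] at h
          have h' : (k.choose x.1 : ℝ) * x.1.factorial * x.2.factorial = k.factorial := by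
            exact_mod_cast h
          have h1 : (x.1.factorial : ℝ) ≠ 0 := by positivity
          have h2 : (x.2.factorial : ℝ) ≠ 0 := by positivity
          have h3 : (k.factorial : ℝ) ≠ 0 := by positivity
          rw [nsmul_eq_mul]
          field_simp
          rw [← h']
          ring

theorem isExpBounded_C {a : ℝ} (ha : 0 ≤ a) : IsExpBounded (C a) a 0 where
  const_nonneg := ha
  rate_nonneg := le_rfl
  coeff_nonneg k := by
    rw [coeff_C]; split_ifs
    exacts [ha, le_rfl]
  coeff_le k := by
    rw [coeff_C]; split_ifs with h
    · simp [h]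
    · simp [zero_pow h]

theorem isExpBounded_one_add {a K b : ℝ} (ha : 0 ≤ a) (hK : 1 ≤ K) (hb : 0 ≤ b)
    (hab : a ≤ K * b) : IsExpBounded (1 + C a * X) K b where
  const_nonneg := zero_le_one.trans hK
  rate_nonneg := hb
  coeff_nonneg := (isLaguerrePoly_one_add ha).coeff_nonneg
  coeff_le k := by
    have hK0 : 0 ≤ K := zero_le_one.trans hK
    rw [coeff_add, coeff_one, coeff_C_mul, coeff_X]
    rcases k with _ | _ | k
    · simpa using hK
    · simpa using hab
    · simp
      positivity

theorem isExpBounded_prod {ι : Type*} (s : Finset ι) (p : ι → ℝ[X]) (K b : ι → ℝ)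
    (hp : ∀ i ∈ s, IsExpBounded (p i) (K i) (b i)) :
    IsExpBounded (∏ i ∈ s, p i) (∏ i ∈ s, K i) (∑ i ∈ s, b i) := by
  classical
  induction s using Finset.induction_on with
  | empty => simpa using isExpBounded_C zero_le_one
  | insert i s hi ih =>
    rw [Finset.prod_insert hi, Finset.prod_insert hi, Finset.sum_insert hi]
    exact (hp i (by simp)).mul (ih fun j hj => hp j (by simp [hj]))

theorem IsExpBounded.mono {p : ℝ[X]} {K b K' b' : ℝ} (hp : IsExpBounded p K b) (hK : K ≤ K')
    (hb : b ≤ b') : IsExpBounded p K' b' where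
  const_nonneg := hp.const_nonneg.trans hK
  rate_nonneg := hp.rate_nonneg.trans hb
  coeff_nonneg := hp.coeff_nonneg
  coeff_le k := by
    have := hp.const_nonneg
    have := this.trans hK
    have := hp.rate_nonneg
    refine (hp.coeff_le k).trans ?_
    gcongr

/-- `c` is the coefficient sequence of a limit of polynomials `p n` of the class `IsLaguerrePoly` of
exponential type at most `σ`: for every `b > σ` the coefficients of the `p n` are dominated,
uniformly in `n`, by those of `K exp (b z)` for some `K`. -/
def IsLaguerreSeq (σ : ℝ) (c : ℕ → ℝ) : Prop :=
  ∃ p : ℕ → ℝ[X], (∀ n, IsLaguerrePoly (p n)) ∧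
    (∀ k, Tendsto (fun n => (p n).coeff k) atTop (𝓝 (c k))) ∧
    ∀ b > σ, ∃ K, ∀ n, IsExpBounded (p n) K b

theorem IsLaguerreSeq.nonneg {σ : ℝ} {c : ℕ → ℝ} (hc : IsLaguerreSeq σ c) (k : ℕ) : 0 ≤ c k := by
  obtain ⟨p, hp, hlim, -⟩ := hc
  exact ge_of_tendsto' (hlim k) fun n => (hp n).coeff_nonneg k

theorem IsLaguerreSeq.exists_bound {σ : ℝ} {c : ℕ → ℝ} (hc : IsLaguerreSeq σ c) {b : ℝ}
    (hb : σ < b) : ∃ K, 0 ≤ K ∧ ∀ k, c k ≤ K * (b ^ k / k.factorial) := by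
  obtain ⟨p, hp, hlim, hbd⟩ := hc
  obtain ⟨K, hK⟩ := hbd b hb
  exact ⟨K, (hK 0).const_nonneg, fun k => le_of_tendsto' (hlim k) fun n => (hK n).coeff_le k⟩

theorem aeval_eq_tsum (p : ℝ[X]) (z : ℂ) : aeval z p = ∑' k, (p.coeff k : ℂ) * z ^ k := by
  rw [aeval_eq_sum_range, tsum_eq_sum (s := Finset.range (p.natDegree + 1))]
  · exact Finset.sum_congr rfl fun k _ => by rw [Complex.real_smul]
  · intro k hk
    rw [coeff_eq_zero_of_natDegree_lt (by simpa [Nat.lt_succ_iff] using hk)]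
    simp

theorem tendsto_aeval_powerSum {p : ℕ → ℝ[X]} {c : ℕ → ℝ} {K b : ℝ}
    (hlim : ∀ k, Tendsto (fun n => (p n).coeff k) atTop (𝓝 (c k)))
    (hbd : ∀ n, IsExpBounded (p n) K b) (z : ℂ) :
    Tendsto (fun n => aeval z (p n)) atTop (𝓝 (powerSum c z)) := by
  simp_rw [aeval_eq_tsum]
  refine tendsto_tsum_of_dominated_convergence
    (bound := fun k => K * ((b * ‖z‖) ^ k / k.factorial))
    ((Real.summable_pow_div_factorial _).mul_left K) (fun k => ?_)
    (Eventually.of_forall fun n k => ?_)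
  · exact ((Complex.continuous_ofReal.tendsto _).comp (hlim k)).mul_const _
  · rw [norm_mul, norm_pow, Complex.norm_real, Real.norm_of_nonneg ((hbd n).coeff_nonneg k),
      mul_pow, mul_div_right_comm, ← mul_assoc]
    exact mul_le_mul_of_nonneg_right ((hbd n).coeff_le k) (by positivity)

/-- A pointwise limit of uniformly dominated polynomials of the class `IsLaguerrePoly` is the sum of
a power series with a Laguerre coefficient sequence: along a subsequence all coefficients
converge. -/
theorem exists_isLaguerreSeq {σ : ℝ} {f : ℂ → ℂ} (p : ℕ → ℝ[X]) (hp : ∀ n, IsLaguerrePoly (p n))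
    (hbd : ∀ b > σ, ∃ K, ∀ n, IsExpBounded (p n) K b)
    (hf : ∀ z, Tendsto (fun n => aeval z (p n)) atTop (𝓝 (f z))) :
    ∃ c, IsLaguerreSeq σ c ∧ f = powerSum c := by
  obtain ⟨K, hK⟩ := hbd (σ + 1) (by linarith)
  obtain ⟨c, -, φ, hφ, hlim⟩ := (isCompact_univ_pi fun k : ℕ =>
    (isCompact_Icc : IsCompact (Icc 0 (K * ((σ + 1) ^ k / k.factorial))))).tendsto_subseq
      (x := fun n k => (p n).coeff k)
      (fun n k _ => ⟨(hK n).coeff_nonneg k, (hK n).coeff_le k⟩)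
  have hlim' := tendsto_pi_nhds.mp hlim
  refine ⟨c, ⟨fun n => p (φ n), fun n => hp _, hlim', fun b hb => ?_⟩, funext fun z => ?_⟩
  · obtain ⟨K', hK'⟩ := hbd b hb
    exact ⟨K', fun n => hK' _⟩
  · exact tendsto_nhds_unique ((hf z).comp hφ.tendsto_atTop)
      (tendsto_aeval_powerSum hlim' (fun n => hK (φ n)) z)

theorem powerSum_zero (c : ℕ → ℝ) : powerSum c 0 = c 0 := by
  rw [powerSum, tsum_eq_single 0 fun k hk => by simp [zero_pow hk]]
  simp

/-- The polynomials `C (1 + α z / n) ^ n ∏_{j < n} (1 + γ_j z)` have exponential type `α`: of the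
factors `1 + γ_j z` only finitely many, each of arbitrarily small type, are not dominated by
`exp (γ_j z)` with a small sum of the remaining `γ_j`. -/
theorem exists_expBound_approx {C₀ α : ℝ} {γ : ℕ → ℝ} (hC : 0 < C₀) (hα : 0 ≤ α)
    (hγ : ∀ j, 0 ≤ γ j) (hanti : Antitone γ) (hs : Summable γ) {b : ℝ} (hb : α < b) :
    ∃ K, ∀ n : ℕ, IsExpBounded
      (C C₀ * (1 + C (α / n) * X) ^ n * ∏ j ∈ Finset.range n, (1 + C (γ j) * X)) K b := by
  obtain ⟨J, hJ⟩ := ((tendsto_sum_nat_add γ).eventually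
    (gt_mem_nhds (show 0 < (b - α) / 2 by linarith))).exists
  -- the first `J` factors are dominated by `M exp (ε z)`, with `J ε ≤ (b - α) / 2`
  set ε := (b - α) / (2 * (J + 1)) with hε
  have hεpos : 0 < ε := div_pos (by linarith) (by positivity)
  set M := max 1 (γ 0 / ε) with hM
  have hM1 : 1 ≤ M := le_max_left _ _
  have hMγ : ∀ j, γ j ≤ M * ε := fun j =>
    (hanti (Nat.zero_le j)).trans ((div_le_iff₀ hεpos).mp (le_max_right _ _))
  set bb : ℕ → ℝ := fun j => if j < J then ε else γ j with hbb
  set KK : ℕ → ℝ := fun j => if j < J then M else 1 with hKK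
  have hfac : ∀ j, IsExpBounded (1 + C (γ j) * X) (KK j) (bb j) := fun j => by
    simp only [hKK, hbb]
    split_ifs
    · exact isExpBounded_one_add (hγ j) hM1 hεpos.le (hMγ j)
    · exact isExpBounded_one_add (hγ j) le_rfl (hγ j) (by simp)
  have hbbnn : ∀ j, 0 ≤ bb j := fun j => (hfac j).rate_nonneg
  have htail : (fun j => bb (j + J)) = fun j => γ (j + J) := by
    funext j
    simp [hbb]
  have hbbs : Summable bb := by
    rw [← summable_nat_add_iff J, htail]
    exact (summable_nat_add_iff J).mpr hs
  have hbbsum : ∑' j, bb j ≤ b - α := by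
    rw [← hbbs.sum_add_tsum_nat_add J, htail]
    have h1 : ∑ j ∈ Finset.range J, bb j = J * ε := by
      rw [Finset.sum_congr rfl fun j hj => if_pos (Finset.mem_range.mp hj)]
      simp
    have h2 : (J : ℝ) * ε ≤ (b - α) / 2 := by
      rw [hε, mul_div_assoc', div_le_div_iff₀ (by positivity) (by norm_num)]
      nlinarith
    linarith
  refine ⟨C₀ * 1 * M ^ J, fun n => ?_⟩
  have h1 : IsExpBounded ((1 + C (α / n) * X) ^ n) 1 α := by
    have h := isExpBounded_prod (Finset.range n) (fun _ => 1 + C (α / n) * X) (fun _ => 1)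
      (fun _ => α / n) fun i _ => isExpBounded_one_add (by positivity) le_rfl (by positivity)
        (by simp)
    simp only [Finset.prod_const, Finset.sum_const, Finset.card_range, one_pow, nsmul_eq_mul] at h
    refine h.mono le_rfl ?_
    rcases eq_or_ne (n : ℝ) 0 with h0 | h0
    · rw [h0]; simpa using hα
    · rw [mul_div_cancel₀ _ h0]
  have h2 := isExpBounded_prod (Finset.range n) _ KK bb fun j _ => hfac j
  refine (((isExpBounded_C hC.le).mul h1).mul h2).mono ?_ ?_
  · refine mul_le_mul_of_nonneg_left ?_ (by positivity)
    simp only [hKK]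
    rw [Finset.prod_ite, Finset.prod_const, Finset.prod_const_one, mul_one]
    refine pow_le_pow_right₀ hM1 ?_
    calc _ ≤ (Finset.range J).card := Finset.card_le_card fun j hj => by
            simpa using (Finset.mem_filter.mp hj).2
      _ = J := Finset.card_range J
  · have := hbbs.sum_le_tsum (Finset.range n) fun j _ => hbbnn j
    linarith

/-- A function of `𝓛⁺` with exponent `α` is the sum of a Laguerre power series of type `α`. -/
theorem exists_isLaguerreSeq_of_rep {g : ℂ → ℂ} (hg : g ∈ laguerrePos) {C₀ : ℂ} {m : ℕ} {α : ℝ}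
    {γ : ℕ → ℝ} (h : IsLaguerreRep g C₀ m α γ) :
    ∃ c, IsLaguerreSeq α c ∧ g = powerSum c := by
  have h0 := h.eq 0
  have hm : m = 0 := by
    by_contra hm
    rw [zero_pow hm] at h0
    have := hg.2.1
    simp [h0] at this
  subst hm
  have hC : g 0 = C₀ := by simpa using h0
  have hCr : C₀ = (C₀.re : ℂ) := Complex.ext rfl (by simpa [hC] using hg.2.2)
  have hCpos : 0 < C₀.re := by simpa [hC] using hg.2.1
  refine exists_isLaguerreSeq
    (fun n : ℕ => C C₀.re * (1 + C (α / n) * X) ^ n * ∏ j ∈ Finset.range n, (1 + C (γ j) * X))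
    (fun n => ?_) (fun b hb => exists_expBound_approx hCpos h.alpha_nonneg h.gamma_nonneg
      h.gamma_antitone h.gamma_summable hb) fun z => ?_
  · have hα := h.alpha_nonneg
    refine ((isLaguerrePoly_C hCpos).mul
      ((isLaguerrePoly_one_add (by positivity)).pow n)).mul
      (isLaguerrePoly_prod _ _ fun j _ => isLaguerrePoly_one_add (h.gamma_nonneg j))
  · have hs : Summable fun j => ‖(γ j : ℂ) * z‖ := by
      simp_rw [norm_mul, Complex.norm_real, Real.norm_of_nonneg (h.gamma_nonneg _)]
      exact h.gamma_summable.mul_right _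
    have h1 := (multipliable_one_add_of_summable hs).hasProd.tendsto_prod_nat
    have h2 := Complex.tendsto_one_add_div_pow_exp ((α : ℂ) * z)
    rw [h.eq z, pow_zero, mul_one]
    refine ((h2.const_mul C₀).mul h1).congr fun n => ?_
    simp only [map_mul, map_pow, map_add, map_one, aeval_C, aeval_X, map_prod,
      Complex.coe_algebraMap]
    rw [← hCr]
    push_cast
    rw [div_mul_eq_mul_div]

theorem coeff_zero_pos_of_powerSum {c : ℕ → ℝ} (h : powerSum c ∈ laguerrePos) : 0 < c 0 := by
  simpa [powerSum_zero] using h.2.1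

/-- The map `f ↦ f (s z) ^ δ` on Laguerre power series. -/
theorem IsLaguerreSeq.exists_pow_dilate {σ : ℝ} {c : ℕ → ℝ} (hc : IsLaguerreSeq σ c) {s : ℝ}
    (hs : 0 < s) {δ : ℕ} (hδ : 0 < δ) :
    ∃ c', IsLaguerreSeq (δ * s * σ) c' ∧ (fun z : ℂ => powerSum c (s * z) ^ δ) = powerSum c' := by
  obtain ⟨p, hp, hlim, hbd⟩ := hc
  refine exists_isLaguerreSeq (fun n => (p n).comp (C s * X) ^ δ)
    (fun n => ((hp n).comp_mul hs).pow δ) (fun b hb => ?_) fun z => ?_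
  · have hδ' : (0 : ℝ) < δ := by exact_mod_cast hδ
    obtain ⟨K, hK⟩ := hbd (b / (δ * s)) (by rwa [gt_iff_lt, lt_div_iff₀ (by positivity), mul_comm])
    refine ⟨K ^ δ, fun n => ?_⟩
    have h1 : IsExpBounded ((p n).comp (C s * X)) K (b / δ) := by
      refine ⟨(hK n).const_nonneg, ?_, ((hp n).comp_mul hs).coeff_nonneg, fun k => ?_⟩
      · have := mul_nonneg (hK n).rate_nonneg hs.le
        rwa [div_mul_eq_mul_div, mul_div_mul_right _ _ hs.ne'] at this
      · rw [comp_C_mul_X_coeff]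
        calc (p n).coeff k * s ^ k ≤ K * ((b / (δ * s)) ^ k / k.factorial) * s ^ k :=
              mul_le_mul_of_nonneg_right ((hK n).coeff_le k) (by positivity)
          _ = K * ((b / (δ * s) * s) ^ k / k.factorial) := by rw [mul_pow]; ring
          _ = _ := by rw [div_mul_eq_mul_div, mul_div_mul_right _ _ hs.ne']
    have h2 := isExpBounded_prod (Finset.range δ) _ (fun _ => K) (fun _ => b / δ) fun _ _ => h1
    simp only [Finset.prod_const, Finset.sum_const, Finset.card_range, nsmul_eq_mul] at h2
    rwa [mul_div_cancel₀ _ hδ'.ne'] at h2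
  · obtain ⟨K, hK⟩ := hbd (σ + 1) (by linarith)
    refine ((tendsto_aeval_powerSum hlim hK ((s : ℂ) * z)).pow δ).congr fun n => ?_
    rw [map_pow, aeval_comp]
    simp

end Sequences

/-! ### The flow `exp (a (θ + z D) D)` on power series -/

section Flow

open Polynomial

/-- The coefficient of `z ^ m` in `((θ + z D) D) ^ j z ^ (m + j)`. -/
noncomputable def besselWeight (θ : ℝ) (m j : ℕ) : ℝ :=
  ∏ i ∈ Finset.range j, ((m + i + 1 : ℝ) * (m + i + θ))

theorem besselWeight_succ (θ : ℝ) (m j : ℕ) :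
    besselWeight θ m (j + 1) = besselWeight θ m j * ((m + j + 1 : ℝ) * (m + j + θ)) :=
  Finset.prod_range_succ _ _

theorem besselWeight_succ' (θ : ℝ) (m j : ℕ) :
    besselWeight θ m (j + 1) = (m + 1 : ℝ) * (m + θ) * besselWeight θ (m + 1) j := by
  rw [besselWeight, Finset.prod_range_succ', mul_comm]
  congr 1
  · simp
  · refine Finset.prod_congr rfl fun i _ => ?_
    push_cast
    ring

theorem besselWeight_nonneg {θ : ℝ} (hθ : 0 ≤ θ) (m j : ℕ) : 0 ≤ besselWeight θ m j :=
  Finset.prod_nonneg fun i _ => by positivity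

/-- If `θ ≤ M + 1`, the weights are at most those for `θ = M + 1`, which are expressed through
binomial coefficients. -/
theorem besselWeight_le {θ : ℝ} (hθ : 0 ≤ θ) {M : ℕ} (hM : θ ≤ M + 1) (m j : ℕ) :
    besselWeight θ m j * m.factorial ≤
      (m + j).factorial * (j.factorial * ((j + (M + m)).choose (M + m) : ℝ)) := by
  induction j with
  | zero => simp [besselWeight]
  | succ j ih =>
    have h := Nat.add_one_mul_choose_eq (j + (M + m)) j
    have h1 : (j + (M + m) + 1).choose (j + 1) = (j + 1 + (M + m)).choose (M + m) := by
      rw [show j + (M + m) + 1 = (j + 1) + (M + m) by ring, Nat.choose_symm_add]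
    have h2 : (j + (M + m)).choose j = (j + (M + m)).choose (M + m) := Nat.choose_symm_add
    rw [h1, h2] at h
    have h' : ((j : ℝ) + (M + m) + 1) * ((j + (M + m)).choose (M + m) : ℝ)
        = ((j + 1 + (M + m)).choose (M + m) : ℝ) * (j + 1) := by exact_mod_cast h
    have hW := besselWeight_nonneg hθ m j
    calc besselWeight θ m (j + 1) * m.factorial
        = (besselWeight θ m j * m.factorial) * ((m + j + 1 : ℝ) * (m + j + θ)) := by
          rw [besselWeight_succ]; ring
      _ ≤ ((m + j).factorial * (j.factorial * ((j + (M + m)).choose (M + m) : ℝ)))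
            * ((m + j + 1 : ℝ) * (j + (M + m) + 1)) := by
          refine mul_le_mul ih ?_ (by positivity) (by positivity)
          refine mul_le_mul_of_nonneg_left ?_ (by positivity)
          linarith
      _ = ((m + j + 1) * (m + j).factorial) * (j.factorial *
            (((j : ℝ) + (M + m) + 1) * ((j + (M + m)).choose (M + m) : ℝ))) := by ring
      _ = _ := by
          rw [h', ← add_assoc m, Nat.factorial_succ, Nat.factorial_succ]
          push_cast
          ring

/-- Majorant of the terms of the double series for `exp (a (θ + z D) D)`: each is dominated by the
corresponding term of a binomial series. -/
theorem flow_term_le {θ : ℝ} (hθ : 0 ≤ θ) {M : ℕ} (hM : θ ≤ M + 1) {K b a x : ℝ} (ha : 0 ≤ a)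
    (hb : 0 ≤ b) (hK : 0 ≤ K) (m j : ℕ) (hx : x ≤ K * (b ^ (m + j) / (m + j).factorial)) :
    besselWeight θ m j / j.factorial * a ^ j * x ≤
      K * (b ^ m / m.factorial) * (((j + (M + m)).choose (M + m) : ℝ) * (a * b) ^ j) := by
  have hW := besselWeight_nonneg hθ m j
  have h := besselWeight_le hθ hM m j
  have h0 : (0 : ℝ) < m.factorial := by positivity
  have h1 : (0 : ℝ) < j.factorial := by positivity
  have h2 : (0 : ℝ) < (m + j).factorial := by positivity
  calc besselWeight θ m j / j.factorial * a ^ j * x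
      ≤ besselWeight θ m j / j.factorial * a ^ j * (K * (b ^ (m + j) / (m + j).factorial)) := by
        gcongr
    _ = (besselWeight θ m j * m.factorial) *
          (a ^ j * K * b ^ (m + j) / (j.factorial * (m + j).factorial * m.factorial)) := by
        field_simp
    _ ≤ ((m + j).factorial * (j.factorial * ((j + (M + m)).choose (M + m) : ℝ))) *
          (a ^ j * K * b ^ (m + j) / (j.factorial * (m + j).factorial * m.factorial)) := by
        gcongr
    _ = _ := by
        rw [mul_pow, pow_add]
        field_simp

theorem summable_flow_row {θ : ℝ} (hθ : 0 ≤ θ) {M : ℕ} (hM : θ ≤ M + 1) {K b a : ℝ} (ha : 0 ≤ a)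
    (hb : 0 ≤ b) (hK : 0 ≤ K) (hab : a * b < 1) {c : ℕ → ℝ} (hc : ∀ k, 0 ≤ c k)
    (hcb : ∀ k, c k ≤ K * (b ^ k / k.factorial)) (m : ℕ) :
    Summable (fun j => besselWeight θ m j / j.factorial * a ^ j * c (m + j)) ∧
      ∑' j, besselWeight θ m j / j.factorial * a ^ j * c (m + j) ≤
        K / (1 - a * b) ^ (M + 1) * ((b / (1 - a * b)) ^ m / m.factorial) := by
  have hnorm : ‖a * b‖ < 1 := by rwa [Real.norm_of_nonneg (mul_nonneg ha hb)]
  have hs := (summable_choose_mul_geometric_of_norm_lt_one (M + m) hnorm).mul_left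
    (K * (b ^ m / m.factorial))
  have hle := fun j => flow_term_le hθ hM ha hb hK m j (hcb (m + j))
  have hs' : Summable (fun j => besselWeight θ m j / j.factorial * a ^ j * c (m + j)) :=
    hs.of_nonneg_of_le (fun j => mul_nonneg (mul_nonneg (div_nonneg
      (besselWeight_nonneg hθ m j) (by positivity)) (by positivity)) (hc _)) hle
  refine ⟨hs', (hs'.tsum_le_tsum hle hs).trans_eq ?_⟩
  rw [tsum_mul_left, tsum_choose_mul_geometric_of_norm_lt_one _ hnorm]
  have : 1 - a * b ≠ 0 := by linarith
  rw [show M + m + 1 = (M + 1) + m by ring, pow_add, div_pow]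
  field_simp

theorem summable_of_rows {F : ℕ → ℕ → ℝ} (h0 : ∀ m j, 0 ≤ F m j) (h1 : ∀ m, Summable (F m))
    (h2 : Summable fun m => ∑' j, F m j) : Summable fun x : ℕ × ℕ => F x.1 x.2 :=
  (summable_prod_of_nonneg fun x => h0 x.1 x.2).mpr ⟨h1, h2⟩

/-- The double series of `exp (a (θ + z D) D) (∑ c_k z ^ k)` converges absolutely on `|z| ≤ R`. -/
theorem summable_flow {θ : ℝ} (hθ : 0 ≤ θ) {K b a R : ℝ} (ha : 0 ≤ a)
    (hb : 0 ≤ b) (hK : 0 ≤ K) (hR : 0 ≤ R) (hab : a * b < 1) {c : ℕ → ℝ} (hc : ∀ k, 0 ≤ c k)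
    (hcb : ∀ k, c k ≤ K * (b ^ k / k.factorial)) :
    Summable fun x : ℕ × ℕ =>
      besselWeight θ x.1 x.2 / x.2.factorial * a ^ x.2 * c (x.1 + x.2) * R ^ x.1 := by
  obtain ⟨M, hM⟩ := exists_nat_ge θ
  have hrow := summable_flow_row hθ (M := M) (by linarith) ha hb hK hab hc hcb
  have hnn : ∀ m j : ℕ, 0 ≤ besselWeight θ m j / j.factorial * a ^ j * c (m + j) := fun m j =>
    mul_nonneg (mul_nonneg (div_nonneg (besselWeight_nonneg hθ m j) (by positivity))
      (by positivity)) (hc _)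
  have hsum : ∀ m : ℕ, ∑' j, besselWeight θ m j / j.factorial * a ^ j * c (m + j) * R ^ m ≤
      K / (1 - a * b) ^ (M + 1) * ((b / (1 - a * b) * R) ^ m / m.factorial) := fun m => by
    rw [tsum_mul_right, mul_pow, mul_div_right_comm, ← mul_assoc]
    exact mul_le_mul_of_nonneg_right (hrow m).2 (pow_nonneg hR _)
  have hs := (Real.summable_pow_div_factorial (b / (1 - a * b) * R)).mul_left
    (K / (1 - a * b) ^ (M + 1))
  have hnn' : ∀ m j : ℕ,
      0 ≤ besselWeight θ m j / j.factorial * a ^ j * c (m + j) * R ^ m :=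
    fun m j => mul_nonneg (hnn m j) (pow_nonneg hR m)
  exact summable_of_rows hnn' (fun m => (hrow m).1.mul_right (R ^ m))
    (hs.of_nonneg_of_le (fun m => tsum_nonneg fun j => hnn' m j) hsum)

/-- The coefficients of `exp (a (θ + z D) D) (∑ c_k z ^ k)`. -/
noncomputable def flowCoeff (θ a : ℝ) (c : ℕ → ℝ) (m : ℕ) : ℝ :=
  ∑' j, besselWeight θ m j / j.factorial * a ^ j * c (m + j)

theorem coeff_besselPoly_pow (θ : ℝ) (p : ℝ[X]) (j m : ℕ) :
    ((besselPoly θ ^ j) p).coeff m = besselWeight θ m j * p.coeff (m + j) := by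
  induction j generalizing m with
  | zero => simp [besselWeight]
  | succ j ih =>
    rw [pow_succ', Module.End.mul_apply, coeff_besselPoly, ih, besselWeight_succ', ← mul_assoc]
    congr 2
    ring

theorem coeff_one_add_besselPoly_pow (θ a : ℝ) (p : ℝ[X]) (n m : ℕ) :
    (((1 + a • besselPoly θ) ^ n) p).coeff m =
      ∑' j, (n.choose j : ℝ) * a ^ j * (besselWeight θ m j * p.coeff (m + j)) := by
  rw [tsum_eq_sum (s := Finset.range (n + 1)), add_comm, (Commute.one_right _).add_pow,
    LinearMap.sum_apply, finsetSum_coeff]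
  · refine Finset.sum_congr rfl fun j _ => ?_
    rw [one_pow, mul_one, _root_.smul_pow, ← nsmul_eq_mul', LinearMap.smul_apply,
      LinearMap.smul_apply, coeff_smul, coeff_smul, coeff_besselPoly_pow, nsmul_eq_mul,
      smul_eq_mul, mul_assoc]
  · intro j hj
    rw [Nat.choose_eq_zero_of_lt (by simpa [Nat.lt_succ_iff] using hj)]
    simp

theorem tendsto_choose_div_pow (j : ℕ) :
    Tendsto (fun n : ℕ => (n.choose j : ℝ) / (n : ℝ) ^ j) atTop (𝓝 (1 / j.factorial)) := by
  have hne : ∀ᶠ n : ℕ in atTop, (n : ℝ) ≠ 0 :=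
    eventually_atTop.mpr ⟨1, fun n hn => by positivity⟩
  have h := (Asymptotics.isEquivalent_iff_tendsto_one (hne.mono fun n hn =>
    div_ne_zero (pow_ne_zero j hn) (Nat.cast_ne_zero.mpr j.factorial_ne_zero))).mp
    (isEquivalent_choose j)
  refine (h.div_const (j.factorial : ℝ)).congr fun n => ?_
  have hj : (j.factorial : ℝ) ≠ 0 := Nat.cast_ne_zero.mpr j.factorial_ne_zero
  simp only [Pi.div_apply]
  field_simp

/-- `exp (a (θ + z D) D)` maps Laguerre power series of type `σ`, `a σ < 1`, to Laguerre power
series of type `σ / (1 - a σ)`, being the limit of the operators `(1 + (a / n) (θ + z D) D) ^ n`. -/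
theorem IsLaguerreSeq.flow {σ : ℝ} {c : ℕ → ℝ} (hc : IsLaguerreSeq σ c) {θ a : ℝ} (hθ : 0 ≤ θ)
    (hσ : 0 ≤ σ) (ha : 0 ≤ a) (haσ : a * σ < 1) :
    IsLaguerreSeq (σ / (1 - a * σ)) (flowCoeff θ a c) := by
  obtain ⟨p, hp, hlim, hbd⟩ := hc
  obtain ⟨M, hM⟩ := exists_nat_ge θ
  have hM' : θ ≤ M + 1 := by linarith
  have hterm : ∀ (n m j : ℕ), (n.choose j : ℝ) * (a / n) ^ j * (besselWeight θ m j *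
      (p n).coeff (m + j)) ≤ besselWeight θ m j / j.factorial * a ^ j * (p n).coeff (m + j) := by
    intro n m j
    have h1 : (n.choose j : ℝ) * (a / n) ^ j ≤ a ^ j / j.factorial := by
      rcases Nat.eq_zero_or_pos n with rfl | hn
      · rcases Nat.eq_zero_or_pos j with rfl | hj
        · simp
        · rw [Nat.choose_eq_zero_of_lt hj]
          simp only [Nat.cast_zero, zero_mul]
          positivity
      · have hn' : (0 : ℝ) < n := by exact_mod_cast hn
        calc (n.choose j : ℝ) * (a / n) ^ j ≤ ((n : ℝ) ^ j / j.factorial) * (a / n) ^ j :=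
              mul_le_mul_of_nonneg_right (Nat.choose_le_pow_div j n) (by positivity)
          _ = _ := by rw [div_pow]; field_simp
    have h2 := mul_nonneg (besselWeight_nonneg hθ m j) ((hp n).coeff_nonneg (m + j))
    calc _ ≤ a ^ j / j.factorial * (besselWeight θ m j * (p n).coeff (m + j)) :=
          mul_le_mul_of_nonneg_right h1 h2
      _ = _ := by ring
  have hnn : ∀ (n m j : ℕ), 0 ≤ (n.choose j : ℝ) * (a / n) ^ j * (besselWeight θ m j *
      (p n).coeff (m + j)) := fun n m j =>
    mul_nonneg (by positivity) (mul_nonneg (besselWeight_nonneg hθ m j) ((hp n).coeff_nonneg _))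
  refine ⟨fun n => ((1 + (a / n) • besselPoly θ) ^ n) (p n),
    fun n => (hp n).pow_bessel hθ (by positivity) n, fun m => ?_, fun b hb => ?_⟩
  · -- a type `b > σ` with `a b < 1`
    obtain ⟨b, hb1, hb2⟩ : ∃ b, σ < b ∧ a * b < 1 := by
      have hcont : Tendsto (fun b => a * b) (𝓝[>] σ) (𝓝 (a * σ)) :=
        ((continuous_const_mul a).tendsto σ).mono_left nhdsWithin_le_nhds
      obtain ⟨b, h1, h2⟩ := ((hcont.eventually (gt_mem_nhds haσ)).and
        self_mem_nhdsWithin).exists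
      exact ⟨b, h2, h1⟩
    obtain ⟨K, hK⟩ := hbd b hb1
    have hnorm : ‖a * b‖ < 1 := by
      rwa [Real.norm_of_nonneg (mul_nonneg ha (hK 0).rate_nonneg)]
    simp_rw [coeff_one_add_besselPoly_pow]
    refine tendsto_tsum_of_dominated_convergence
      ((summable_choose_mul_geometric_of_norm_lt_one (M + m) hnorm).mul_left
        (K * (b ^ m / m.factorial))) (fun j => ?_) (Eventually.of_forall fun n j => ?_)
    · have h1 := ((tendsto_choose_div_pow j).mul_const (a ^ j)).mul
        ((hlim (m + j)).const_mul (besselWeight θ m j))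
      convert! h1 using 2
      · rw [div_pow]; ring
      · ring
    · rw [Real.norm_of_nonneg (hnn n m j)]
      exact (hterm n m j).trans (flow_term_le hθ hM' ha (hK n).rate_nonneg (hK n).const_nonneg
        m j ((hK n).coeff_le _))
  · -- `b = b₀ / (1 - a b₀)` for `b₀ = b / (1 + a b)`
    have h1 : 0 < 1 - a * σ := by linarith
    have hb0 : 0 < b := (div_nonneg hσ h1.le).trans_lt hb
    have h2 : 0 < 1 + a * b := by positivity
    have hb1 : σ < b / (1 + a * b) := by
      rw [gt_iff_lt, div_lt_iff₀ h1] at hb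
      rw [lt_div_iff₀ h2]
      linarith
    have hb2 : a * (b / (1 + a * b)) < 1 := by
      rw [mul_div_assoc', div_lt_one h2]
      linarith
    have hb3 : b / (1 + a * b) / (1 - a * (b / (1 + a * b))) = b := by
      have : 1 - a * (b / (1 + a * b)) = 1 / (1 + a * b) := by field_simp; ring
      rw [this]
      field_simp
    obtain ⟨K, hK⟩ := hbd _ hb1
    refine ⟨K / (1 - a * (b / (1 + a * b))) ^ (M + 1), fun n => ⟨?_, hb0.le,
      ((hp n).pow_bessel hθ (by positivity) n).coeff_nonneg, fun m => ?_⟩⟩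
    · exact div_nonneg (hK n).const_nonneg (pow_nonneg (by linarith) _)
    · have hrow := summable_flow_row hθ hM' ha (hK n).rate_nonneg (hK n).const_nonneg hb2
        (hK n).coeff_nonneg (hK n).coeff_le m
      rw [hb3] at hrow
      rw [coeff_one_add_besselPoly_pow]
      exact ((hrow.1.of_nonneg_of_le (hnn n m) (hterm n m)).tsum_le_tsum (hterm n m) hrow.1).trans
        hrow.2

end Flow

/-! ### Limits of polynomials with negative zeros lie in `𝓛⁺` -/

section Closure

open Polynomial

theorem one_add_sum_le_prod_one_add {ι : Type*} {s : Finset ι} {f : ι → ℝ}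
    (hf : ∀ i ∈ s, 0 ≤ f i) : 1 + ∑ i ∈ s, f i ≤ ∏ i ∈ s, (1 + f i) := by
  classical
  induction s using Finset.induction_on with
  | empty => simp
  | insert i s hi ih =>
    rw [Finset.prod_insert hi, Finset.sum_insert hi]
    have h1 := ih fun j hj => hf j (by simp [hj])
    have h2 := hf i (by simp)
    have h3 : 0 ≤ ∑ j ∈ s, f j := Finset.sum_nonneg fun j hj => hf j (by simp [hj])
    nlinarith

theorem norm_one_add_mul_exp_neg_sub_one_le {w : ℂ} {R : ℝ} (hw : ‖w‖ ≤ R) :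
    ‖(1 + w) * Complex.exp (-w) - 1‖ ≤ ((1 + R) * Real.exp R + 1) * ‖w‖ ^ 2 := by
  have h := Complex.norm_exp_sub_sum_le_norm_mul_exp (-w) 2
  simp only [Finset.sum_range_succ, Finset.sum_range_zero, zero_add, pow_zero, Nat.factorial_zero,
    Nat.cast_one, div_one, pow_one, Nat.factorial_one, norm_neg] at h
  have hR : 0 ≤ R := (norm_nonneg w).trans hw
  have h1 : ‖1 + w‖ ≤ 1 + R := (norm_add_le _ _).trans (by simpa using hw)
  calc ‖(1 + w) * Complex.exp (-w) - 1‖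
      = ‖(1 + w) * (Complex.exp (-w) - (1 + -w)) - w ^ 2‖ := by congr 1; ring
    _ ≤ ‖1 + w‖ * ‖Complex.exp (-w) - (1 + -w)‖ + ‖w‖ ^ 2 := by
        rw [← norm_mul, ← norm_pow]; exact norm_sub_le _ _
    _ ≤ (1 + R) * (‖w‖ ^ 2 * Real.exp R) + ‖w‖ ^ 2 := by
        have h2 : ‖w‖ ^ 2 * Real.exp ‖w‖ ≤ ‖w‖ ^ 2 * Real.exp R := by gcongr
        gcongr
        exact h.trans h2
    _ = _ := by ring

theorem le_div_of_antitone {γ : ℕ → ℝ} {S : ℝ} (hanti : Antitone γ) (hnn : ∀ j, 0 ≤ γ j)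
    (hs : Summable γ) (hS : ∑' j, γ j ≤ S) (j : ℕ) : γ j ≤ S / (j + 1) := by
  rw [le_div_iff₀ (by positivity)]
  calc γ j * (j + 1) = ∑ _i ∈ Finset.range (j + 1), γ j := by simp; ring
    _ ≤ ∑ i ∈ Finset.range (j + 1), γ i :=
        Finset.sum_le_sum fun i hi => hanti (Nat.lt_succ_iff.mp (Finset.mem_range.mp hi))
    _ ≤ ∑' i, γ i := hs.sum_le_tsum _ fun i _ => hnn i
    _ ≤ S := hS

/-- A product of genus zero, written with the convergence factors `exp (-γ_j z)`. -/
theorem tprod_one_add_eq {γ : ℕ → ℝ} (hnn : ∀ j, 0 ≤ γ j) (hs : Summable γ) (z : ℂ) :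
    ∏' j, (1 + ((1 + (γ j : ℂ) * z) * Complex.exp (-((γ j : ℂ) * z)) - 1)) =
      (∏' j, (1 + (γ j : ℂ) * z)) * Complex.exp (-(((∑' j, γ j : ℝ) : ℂ) * z)) := by
  have h1 : Summable fun j => ‖(γ j : ℂ) * z‖ := by
    simp_rw [norm_mul, Complex.norm_real, Real.norm_of_nonneg (hnn _)]
    exact hs.mul_right _
  have h2 : HasSum (fun j => -((γ j : ℂ) * z)) (-(((∑' j, γ j : ℝ) : ℂ) * z)) :=
    ((Complex.hasSum_ofReal.mpr hs.hasSum).mul_right z).neg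
  have h3 := (multipliable_one_add_of_summable h1).hasProd.mul h2.cexp
  refine Eq.trans (tprod_congr fun j => ?_) h3.tprod_eq
  simp

/-- Every Laguerre power series that is positive at the origin is in `𝓛⁺`. Along a subsequence the
reciprocal zeros of the approximating polynomials, in decreasing order, converge one by one, and so
do their sums; the sum lost in the limit becomes the exponent. -/
theorem IsLaguerreSeq.mem_laguerrePos {σ : ℝ} {c : ℕ → ℝ} (hc : IsLaguerreSeq σ c)
    (h0 : 0 < c 0) : powerSum c ∈ laguerrePos := by
  obtain ⟨p, hp, hlim, hbd⟩ := hc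
  obtain ⟨K, hK⟩ := hbd (σ + 1) (by linarith)
  have hpt := tendsto_aeval_powerSum hlim hK
  choose M γ hanti hnn hsupp hfac using fun n => (hp n).exists_factorization
  have hsum : ∀ n, Summable (γ n) := fun n =>
    summable_of_ne_finset_zero (s := Finset.range (M n)) fun j hj => hsupp n j (by simpa using hj)
  have htsum : ∀ n, ∑' j, γ n j = ∑ j ∈ Finset.range (M n), γ n j := fun n =>
    tsum_eq_sum fun j hj => hsupp n j (by simpa using hj)
  -- the sums are bounded, since `1 + ∑ γ_j ≤ ∏ (1 + γ_j) = p (1) / p (0)` converges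
  obtain ⟨S, hS⟩ : ∃ S, ∀ n, ∑' j, γ n j ≤ S := by
    have h1 : Tendsto (fun n => ‖aeval (1 : ℂ) (p n)‖ / (p n).coeff 0) atTop
        (𝓝 (‖powerSum c 1‖ / c 0)) := (hpt 1).norm.div (hlim 0) h0.ne'
    obtain ⟨S, hS⟩ := h1.bddAbove_range
    refine ⟨S, fun n => le_trans ?_ (hS ⟨n, rfl⟩)⟩
    have h2 : ‖aeval (1 : ℂ) (p n)‖
        = (p n).coeff 0 * ∏ j ∈ Finset.range (M n), (1 + γ n j) := by
      rw [hfac, norm_mul, Complex.norm_real, Real.norm_of_nonneg (hp n).coeff_zero_pos.le,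
        norm_prod]
      congr 1
      refine Finset.prod_congr rfl fun j _ => ?_
      rw [mul_one, ← Complex.ofReal_one, ← Complex.ofReal_add, Complex.norm_real,
        Real.norm_of_nonneg (by linarith [hnn n j])]
    simp only [h2]
    rw [mul_div_cancel_left₀ _ (hp n).coeff_zero_pos.ne', htsum]
    have h3 := one_add_sum_le_prod_one_add (s := Finset.range (M n)) (f := γ n)
      (fun j _ => hnn n j)
    linarith
  have hγS : ∀ n j, γ n j ≤ S := fun n j =>
    ((hsum n).le_tsum j fun i _ => hnn n i).trans (hS n)
  obtain ⟨⟨γ', s⟩, -, φ, hφ, hconv⟩ := ((isCompact_univ_pi fun _ : ℕ =>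
    (isCompact_Icc : IsCompact (Icc 0 S))).prod
    (isCompact_Icc : IsCompact (Icc 0 S))).tendsto_subseq
      (x := fun n => (γ n, ∑' j, γ n j))
      (fun n => ⟨fun j _ => ⟨hnn n j, hγS n j⟩, tsum_nonneg (hnn n), hS n⟩)
  have hconv1 : ∀ j, Tendsto (fun n => γ (φ n) j) atTop (𝓝 (γ' j)) :=
    tendsto_pi_nhds.mp ((continuous_fst.tendsto _).comp hconv)
  have hconv2 : Tendsto (fun n => ∑' j, γ (φ n) j) atTop (𝓝 s) :=
    (continuous_snd.tendsto _).comp hconv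
  have hnn' : ∀ j, 0 ≤ γ' j := fun j => ge_of_tendsto' (hconv1 j) fun n => hnn _ j
  have hanti' : Antitone γ' := fun i j hij =>
    le_of_tendsto_of_tendsto' (hconv1 j) (hconv1 i) fun n => hanti _ hij
  have hpart : ∀ k, ∑ j ∈ Finset.range k, γ' j ≤ s := fun k =>
    le_of_tendsto_of_tendsto' (tendsto_finsetSum _ fun j _ => hconv1 j) hconv2 fun n =>
      (hsum _).sum_le_tsum _ fun j _ => hnn _ j
  have hs' : Summable γ' := summable_of_sum_range_le hnn' hpart
  have hts' : ∑' j, γ' j ≤ s := hs'.tsum_le_of_sum_range_le hpart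
  -- with the factors `exp (-γ_j z)` the products converge, dominated through `γ_j ≤ S / (j + 1)`
  refine ⟨⟨c 0, 0, s - ∑' j, γ' j, γ', ⟨by linarith, hanti', hnn', hs', fun z => ?_⟩⟩, ?_, ?_⟩
  · have hE : Tendsto (fun n => ∏' j, (1 + ((1 + (γ (φ n) j : ℂ) * z) *
        Complex.exp (-((γ (φ n) j : ℂ) * z)) - 1))) atTop
        (𝓝 (∏' j, (1 + ((1 + (γ' j : ℂ) * z) * Complex.exp (-((γ' j : ℂ) * z)) - 1)))) := by
      refine tendsto_tprod_one_add_of_dominated_convergence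
        (bound := fun j : ℕ => ((1 + S * ‖z‖) * Real.exp (S * ‖z‖) + 1) *
          ((S * ‖z‖) ^ 2 * (1 / ((j : ℝ) + 1) ^ 2))) ?_ (fun j => ?_)
          (Eventually.of_forall fun n j => ?_)
      · have h := (summable_nat_add_iff 1).mpr (Real.summable_one_div_nat_pow.mpr one_lt_two)
        push_cast at h
        exact (h.mul_left _).mul_left _
      · have h : Continuous fun x : ℝ =>
            (1 + (x : ℂ) * z) * Complex.exp (-((x : ℂ) * z)) - 1 := by fun_prop
        exact (h.tendsto _).comp (hconv1 j)
      · have hn : ‖(γ (φ n) j : ℂ) * z‖ = γ (φ n) j * ‖z‖ := by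
          rw [norm_mul, Complex.norm_real, Real.norm_of_nonneg (hnn _ j)]
        have hS0 : 0 ≤ S := (hnn 0 0).trans (hγS 0 0)
        refine (norm_one_add_mul_exp_neg_sub_one_le (R := S * ‖z‖) ?_).trans ?_
        · rw [hn]
          exact mul_le_mul_of_nonneg_right (hγS _ j) (norm_nonneg z)
        · refine mul_le_mul_of_nonneg_left ?_ (by positivity)
          rw [hn]
          have h1 := le_div_of_antitone (hanti (φ n)) (hnn (φ n)) (hsum _) (hS _) j
          calc (γ (φ n) j * ‖z‖) ^ 2 ≤ (S / (j + 1) * ‖z‖) ^ 2 := by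
                have := hnn (φ n) j
                gcongr
            _ = _ := by field_simp
    have hexp : Tendsto (fun n => Complex.exp (((∑' j, γ (φ n) j : ℝ) : ℂ) * z)) atTop
        (𝓝 (Complex.exp ((s : ℂ) * z))) := by
      have h : Continuous fun x : ℝ => Complex.exp ((x : ℂ) * z) := by fun_prop
      exact (h.tendsto _).comp hconv2
    have hc0 : Tendsto (fun n => ((p (φ n)).coeff 0 : ℂ)) atTop (𝓝 (c 0 : ℂ)) :=
      (Complex.continuous_ofReal.tendsto _).comp ((hlim 0).comp hφ.tendsto_atTop)
    have hall := (hc0.mul hexp).mul hE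
    have heq := tendsto_nhds_unique ((hpt z).comp hφ.tendsto_atTop) (hall.congr fun n => ?_)
    · rw [heq, tprod_one_add_eq hnn' hs' z, pow_zero, mul_one, Complex.ofReal_sub, sub_mul,
        sub_eq_add_neg, Complex.exp_add]
      ring
    · rw [tprod_one_add_eq (hnn _) (hsum _) z, Function.comp, hfac]
      have h1 : ∏' j, (1 + (γ (φ n) j : ℂ) * z)
          = ∏ j ∈ Finset.range (M (φ n)), (1 + (γ (φ n) j : ℂ) * z) :=
        tprod_eq_prod fun j hj => by rw [hsupp _ j (by simpa using hj)]; simp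
      rw [h1, mul_assoc, mul_comm _ (Complex.exp (-_)), ← mul_assoc (Complex.exp _),
        ← Complex.exp_add, add_neg_cancel, Complex.exp_zero, one_mul]
  · simpa [powerSum_zero] using h0
  · simp [powerSum_zero]

end Closure

/-! ### The flow as a function of time and space -/

section PowerSeries

theorem norm_powerSum_term_le {d : ℕ → ℝ} {K b : ℝ} (hd : ∀ k, 0 ≤ d k)
    (hb : ∀ k, d k ≤ K * (b ^ k / k.factorial)) (z : ℂ) {r : ℝ} (hr : ‖z‖ ≤ r) (k : ℕ) :
    ‖(d k : ℂ) * z ^ k‖ ≤ K * ((b * r) ^ k / k.factorial) := by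
  rw [norm_mul, norm_pow, Complex.norm_real, Real.norm_of_nonneg (hd k), mul_pow,
    mul_div_right_comm, ← mul_assoc]
  exact mul_le_mul (hb k) (pow_le_pow_left₀ (norm_nonneg z) hr k) (by positivity)
    ((hd k).trans (hb k))

theorem norm_powerSum_le {d : ℕ → ℝ} {K b : ℝ} (hd : ∀ k, 0 ≤ d k)
    (hb : ∀ k, d k ≤ K * (b ^ k / k.factorial)) (z : ℂ) :
    ‖powerSum d z‖ ≤ K * Real.exp (b * ‖z‖) := by
  refine tsum_of_norm_bounded ?_ (norm_powerSum_term_le hd hb z le_rfl)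
  rw [Real.exp_eq_exp_ℝ]
  exact (NormedSpace.expSeries_div_hasSum_exp (b * ‖z‖)).mul_left K

theorem hasDerivAt_powerSum {d : ℕ → ℝ} {K b : ℝ} (hd : ∀ k, 0 ≤ d k)
    (hb : ∀ k, d k ≤ K * (b ^ k / k.factorial)) (z : ℂ) :
    HasDerivAt (powerSum d) (powerSum (fun k => (k + 1) * d (k + 1)) z) z := by
  have hs := (Real.summable_pow_div_factorial (b * (‖z‖ + 1))).mul_left K
  have hdiff : ∀ k : ℕ, DifferentiableOn ℂ (fun w : ℂ => (d k : ℂ) * w ^ k)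
      (Metric.ball 0 (‖z‖ + 1)) := fun k => by fun_prop
  have hle : ∀ (k : ℕ), ∀ w ∈ Metric.ball (0 : ℂ) (‖z‖ + 1),
      ‖(d k : ℂ) * w ^ k‖ ≤ K * ((b * (‖z‖ + 1)) ^ k / k.factorial) := fun k w hw =>
    norm_powerSum_term_le hd hb w (by simpa using (Metric.mem_ball.mp hw).le) k
  have hz : z ∈ Metric.ball (0 : ℂ) (‖z‖ + 1) := by simp
  have h1 := Complex.hasSum_deriv_of_summable_norm hs hdiff Metric.isOpen_ball hle hz
  have h2 := (Complex.differentiableOn_tsum_of_summable_norm hs hdiff Metric.isOpen_ball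
    hle).differentiableAt (Metric.isOpen_ball.mem_nhds hz)
  have h3 : powerSum (fun k => (k + 1) * d (k + 1)) z = deriv (powerSum d) z := by
    refine HasSum.tsum_eq ?_
    have h4 := (hasSum_nat_add_iff' 1).mpr h1
    simp only [Finset.range_one, Finset.sum_singleton, pow_zero, mul_one, deriv_const, sub_zero]
      at h4
    refine h4.congr_fun fun k => ?_
    simp
    ring
  rw [h3]
  exact h2.hasDerivAt

theorem shift_bound {d : ℕ → ℝ} {K b : ℝ} (hb : ∀ k, d k ≤ K * (b ^ k / k.factorial)) (k : ℕ) :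
    (k + 1) * d (k + 1) ≤ (K * b) * (b ^ k / k.factorial) := by
  calc (k + 1) * d (k + 1) ≤ (k + 1) * (K * (b ^ (k + 1) / (k + 1).factorial)) :=
        mul_le_mul_of_nonneg_left (hb _) (by positivity)
    _ = _ := by
      rw [Nat.factorial_succ, pow_succ]
      push_cast
      field_simp

theorem summable_powerSum {d : ℕ → ℝ} {K b : ℝ} (hd : ∀ k, 0 ≤ d k)
    (hb : ∀ k, d k ≤ K * (b ^ k / k.factorial)) (z : ℂ) :
    Summable fun k => (d k : ℂ) * z ^ k :=
  Summable.of_norm_bounded ((Real.summable_pow_div_factorial _).mul_left K)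
    (norm_powerSum_term_le hd hb z le_rfl)

/-- The operator `z D ^ 2 + θ D` on power series. -/
theorem bessel_powerSum {d : ℕ → ℝ} {K b : ℝ} (hd : ∀ k, 0 ≤ d k)
    (hb : ∀ k, d k ≤ K * (b ^ k / k.factorial)) (θ : ℝ) (z : ℂ) :
    z * deriv (deriv (powerSum d)) z + θ * deriv (powerSum d) z =
      ∑' k : ℕ, (((k + 1) * (k + θ) * d (k + 1) : ℝ) : ℂ) * z ^ k := by
  have h1 : deriv (powerSum d) = powerSum (fun k => (k + 1) * d (k + 1)) :=
    funext fun w => (hasDerivAt_powerSum hd hb w).deriv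
  have hd1 : ∀ k : ℕ, 0 ≤ ((k : ℝ) + 1) * d (k + 1) := fun k =>
    mul_nonneg (by positivity) (hd _)
  have hb1 : ∀ k : ℕ, ((k : ℝ) + 1) * d (k + 1) ≤ (K * b) * (b ^ k / k.factorial) := shift_bound hb
  have h2 := (hasDerivAt_powerSum hd1 hb1 z).deriv
  have hd2 : ∀ k : ℕ, 0 ≤ ((k : ℝ) + 1) * (((k + 1 : ℕ) + 1) * d (k + 1 + 1)) := fun k =>
    mul_nonneg (by positivity) (hd1 _)
  have hs2 := summable_powerSum hd2 (shift_bound hb1) z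
  have hs1 := summable_powerSum hd1 hb1 z
  rw [h1, h2]
  have hz : z * powerSum (fun k => ((k : ℝ) + 1) * (((k + 1 : ℕ) + 1) * d (k + 1 + 1))) z
      = ∑' k : ℕ, ((k * ((k + 1) * d (k + 1)) : ℝ) : ℂ) * z ^ k := by
    have h3 := hs2.hasSum.mul_left z
    have h4 : HasSum (fun k : ℕ => ((k * ((k + 1) * d (k + 1)) : ℝ) : ℂ) * z ^ k)
        (z * powerSum (fun k => ((k : ℝ) + 1) * (((k + 1 : ℕ) + 1) * d (k + 1 + 1))) z) := by
      rw [← hasSum_nat_add_iff' 1]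
      simp only [Finset.range_one, Finset.sum_singleton, Nat.cast_zero, zero_mul,
        Complex.ofReal_zero, sub_zero]
      refine h3.congr_fun fun k => ?_
      push_cast
      ring
    exact h4.tsum_eq.symm
  have hs0 : Summable fun k : ℕ => ((k * ((k + 1) * d (k + 1)) : ℝ) : ℂ) * z ^ k := by
    rw [← summable_nat_add_iff 1]
    refine (hs2.mul_left z).congr fun k => ?_
    push_cast
    ring
  rw [hz, powerSum, ← tsum_mul_left, ← hs0.tsum_add (hs1.mul_left _)]
  refine tsum_congr fun k => ?_
  push_cast
  ring

end PowerSeries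

section TimeEvolution

variable {θ σ s : ℝ} {c : ℕ → ℝ}

theorem flowCoeff_zero (θ : ℝ) (c : ℕ → ℝ) : flowCoeff θ 0 c = c := by
  funext m
  rw [flowCoeff, tsum_eq_single 0 fun j hj => by simp [zero_pow hj]]
  simp [besselWeight]

/-- The coefficient of `t ^ j z ^ m` in `exp (s t (θ + z D) D) (∑ c_k z ^ k)`. -/
noncomputable def evolutionCoeff (θ s : ℝ) (c : ℕ → ℝ) (x : ℕ × ℕ) : ℝ :=
  besselWeight θ x.1 x.2 / x.2.factorial * s ^ x.2 * c (x.1 + x.2)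

theorem evolutionCoeff_nonneg (hθ : 0 ≤ θ) (hs : 0 ≤ s) (hc : ∀ k, 0 ≤ c k) (x : ℕ × ℕ) :
    0 ≤ evolutionCoeff θ s c x :=
  mul_nonneg (mul_nonneg (div_nonneg (besselWeight_nonneg hθ _ _) (by positivity)) (by positivity))
    (hc _)

/-- The evolution as a power series in time and space, with complex time. -/
noncomputable def evolution (θ s : ℝ) (c : ℕ → ℝ) (t z : ℂ) : ℂ :=
  ∑' x : ℕ × ℕ, (evolutionCoeff θ s c x : ℂ) * t ^ x.2 * z ^ x.1

/-- The double series converges for times in a disc of radius larger than `1`. -/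
theorem IsLaguerreSeq.exists_summable_evolution (hc : IsLaguerreSeq σ c) (hθ : 0 ≤ θ)
    (hσ : 0 ≤ σ) (hs : 0 ≤ s) (hsσ : s * σ < 1) :
    ∃ T > 1, ∀ R ≥ 0, Summable fun x : ℕ × ℕ => evolutionCoeff θ s c x * T ^ x.2 * R ^ x.1 := by
  obtain ⟨T, hT, b, hb, hTb⟩ : ∃ T > 1, ∃ b > σ, (s * T) * b < 1 := by
    have hcont : Tendsto (fun ε : ℝ => s * (1 + ε) * (σ + ε)) (𝓝[>] 0)
        (𝓝 (s * (1 + 0) * (σ + 0))) :=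
      ((by fun_prop : Continuous fun ε : ℝ => s * (1 + ε) * (σ + ε)).tendsto 0).mono_left
        nhdsWithin_le_nhds
    obtain ⟨ε, h1, h2⟩ := ((hcont.eventually (gt_mem_nhds (by simpa using hsσ))).and
      self_mem_nhdsWithin).exists
    have h2' : 0 < ε := h2
    exact ⟨1 + ε, by linarith, σ + ε, by linarith, h1⟩
  obtain ⟨K, hK, hcb⟩ := hc.exists_bound hb
  refine ⟨T, hT, fun R hR => ?_⟩
  refine (summable_flow hθ (mul_nonneg hs (by linarith)) (hσ.trans hb.le) hK hR hTb hc.nonneg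
    hcb).congr fun x => ?_
  rw [evolutionCoeff, mul_pow]
  ring

theorem norm_evolution_term_le (hθ : 0 ≤ θ) (hs : 0 ≤ s) (hc : ∀ k, 0 ≤ c k) {t z : ℂ} {T R : ℝ}
    (ht : ‖t‖ ≤ T) (hz : ‖z‖ ≤ R) (x : ℕ × ℕ) :
    ‖(evolutionCoeff θ s c x : ℂ) * t ^ x.2 * z ^ x.1‖ ≤
      evolutionCoeff θ s c x * T ^ x.2 * R ^ x.1 := by
  have h := evolutionCoeff_nonneg (θ := θ) (s := s) hθ hs hc x
  have := (norm_nonneg t).trans ht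
  rw [norm_mul, norm_mul, norm_pow, norm_pow, Complex.norm_real, Real.norm_of_nonneg h]
  gcongr

theorem evolution_eq_powerSum (hθ : 0 ≤ θ) (hs : 0 ≤ s) (hc : ∀ k, 0 ≤ c k)
    (hsum : ∀ R ≥ 0, Summable fun x : ℕ × ℕ => evolutionCoeff θ s c x * 1 ^ x.2 * R ^ x.1)
    {t : ℝ} (ht : t ∈ Icc (0 : ℝ) 1) (z : ℂ) :
    evolution θ s c t z = powerSum (flowCoeff θ (s * t) c) z := by
  have h1 : Summable fun x : ℕ × ℕ => (evolutionCoeff θ s c x : ℂ) * (t : ℂ) ^ x.2 * z ^ x.1 :=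
    Summable.of_norm_bounded (hsum ‖z‖ (norm_nonneg z)) fun x =>
      norm_evolution_term_le hθ hs hc (by simpa [abs_of_nonneg ht.1] using ht.2) le_rfl x
  rw [evolution, h1.tsum_prod]
  refine tsum_congr fun m => ?_
  simp only
  rw [tsum_mul_right, flowCoeff, Complex.ofReal_tsum]
  congr 1
  refine tsum_congr fun j => ?_
  rw [evolutionCoeff, mul_pow]
  push_cast
  ring

theorem flowCoeff_mono (hθ : 0 ≤ θ) (hc : ∀ k, 0 ≤ c k) {t : ℝ} (ht : 0 ≤ t)
    (hts : t ≤ s) {m : ℕ}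
    (hsum : Summable fun j => besselWeight θ m j / j.factorial * s ^ j * c (m + j)) :
    flowCoeff θ t c m ≤ flowCoeff θ s c m := by
  have hle : ∀ j : ℕ, besselWeight θ m j / j.factorial * t ^ j * c (m + j) ≤
      besselWeight θ m j / j.factorial * s ^ j * c (m + j) := fun j => by
    have := besselWeight_nonneg hθ m j
    have := hc (m + j)
    gcongr
  exact (hsum.of_nonneg_of_le (fun j => evolutionCoeff_nonneg (θ := θ) (s := t) hθ ht hc (m, j))
    hle).tsum_le_tsum hle hsum

theorem IsLaguerreSeq.summable_flowCoeff (hc : IsLaguerreSeq σ c) (hθ : 0 ≤ θ)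
    (hσ : 0 ≤ σ) (hs : 0 ≤ s) (hsσ : s * σ < 1) (m : ℕ) :
    Summable fun j => besselWeight θ m j / j.factorial * s ^ j * c (m + j) := by
  obtain ⟨T, hT, hsum⟩ := hc.exists_summable_evolution hθ hσ hs hsσ
  refine ((hsum 1 zero_le_one).prod_factor m).of_nonneg_of_le
    (fun j => evolutionCoeff_nonneg (θ := θ) (s := s) hθ hs hc.nonneg (m, j)) fun j => ?_
  have h1 := evolutionCoeff_nonneg (θ := θ) (s := s) hθ hs hc.nonneg (m, j)
  rw [one_pow, mul_one]
  exact le_mul_of_one_le_right h1 (one_le_pow₀ hT.le)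

/-- The evolution solves `∂_t f = s (z f'' + θ f')`, coefficient by coefficient. -/
theorem IsLaguerreSeq.hasDerivAt_evolution (hc : IsLaguerreSeq σ c) (hθ : 0 ≤ θ)
    (hσ : 0 ≤ σ) (hs : 0 ≤ s) (hsσ : s * σ < 1) {t : ℝ} (ht : t ∈ Icc (0 : ℝ) 1) (z : ℂ) :
    HasDerivAt (fun w => evolution θ s c w z)
      (s * (z * deriv (deriv (powerSum (flowCoeff θ (s * t) c))) z
        + θ * deriv (powerSum (flowCoeff θ (s * t) c)) z)) (t : ℂ) := by
  obtain ⟨T, hT, hsum⟩ := hc.exists_summable_evolution hθ hσ hs hsσ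
  have hst : 0 ≤ s * t := mul_nonneg hs ht.1
  have hstσ : s * t * σ < 1 := by
    refine lt_of_le_of_lt ?_ hsσ
    have := mul_le_mul_of_nonneg_left ht.2 (mul_nonneg hs hσ)
    linarith
  have hflow := hc.flow hθ hσ hst hstσ
  have hσ' : 0 ≤ σ / (1 - s * t * σ) := div_nonneg hσ (by linarith)
  obtain ⟨K, hK, hKb⟩ := hflow.exists_bound (lt_add_one (σ / (1 - s * t * σ)))
  rw [bessel_powerSum hflow.nonneg hKb]
  have hsumz := hsum ‖z‖ (norm_nonneg z)
  have hdiff : ∀ x : ℕ × ℕ, DifferentiableOn ℂ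
      (fun w : ℂ => (evolutionCoeff θ s c x : ℂ) * w ^ x.2 * z ^ x.1) (Metric.ball 0 T) :=
    fun x => by fun_prop
  have hle : ∀ (x : ℕ × ℕ), ∀ w ∈ Metric.ball (0 : ℂ) T,
      ‖(evolutionCoeff θ s c x : ℂ) * w ^ x.2 * z ^ x.1‖
        ≤ evolutionCoeff θ s c x * T ^ x.2 * ‖z‖ ^ x.1 := fun x w hw =>
    norm_evolution_term_le hθ hs hc.nonneg (by simpa using (Metric.mem_ball.mp hw).le) le_rfl x
  have htT : (t : ℂ) ∈ Metric.ball (0 : ℂ) T := by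
    simpa [abs_of_nonneg ht.1] using ht.2.trans_lt hT
  have h1 := Complex.hasSum_deriv_of_summable_norm hsumz hdiff Metric.isOpen_ball hle htT
  have h2 := (Complex.differentiableOn_tsum_of_summable_norm hsumz hdiff Metric.isOpen_ball
    hle).differentiableAt (Metric.isOpen_ball.mem_nhds htT)
  refine h2.hasDerivAt.congr_deriv ?_
  -- shift `j`, the exponent of `t`, by one
  have hinj : Function.Injective fun x : ℕ × ℕ => (x.1, x.2 + 1) := by
    rintro ⟨m, j⟩ ⟨m', j'⟩ h
    simpa using h
  have h3 := (hinj.hasSum_iff fun x hx => ?_).mpr h1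
  · have hrow : ∀ m : ℕ, HasSum (fun j : ℕ => deriv (fun w : ℂ =>
        (evolutionCoeff θ s c (m, j + 1) : ℂ) * w ^ (j + 1) * z ^ m) t)
        (s * ((((m + 1) * (m + θ) * flowCoeff θ (s * t) c (m + 1) : ℝ) : ℂ) * z ^ m)) := by
      intro m
      have h4 := Complex.hasSum_ofReal.mpr
        (hc.summable_flowCoeff hθ hσ hst hstσ (m + 1)).hasSum
      have h5 := h4.mul_left ((s * ((m + 1) * (m + θ)) : ℝ) * z ^ m : ℂ)
      have h6 : (s * ((((m + 1) * (m + θ) * flowCoeff θ (s * t) c (m + 1) : ℝ) : ℂ) * z ^ m))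
          = ((s * ((m + 1) * (m + θ)) : ℝ) * z ^ m : ℂ) * ((∑' j,
            besselWeight θ (m + 1) j / j.factorial * (s * t) ^ j * c (m + 1 + j) : ℝ) : ℂ) := by
        rw [flowCoeff]
        push_cast
        ring
      rw [h6]
      refine h5.congr_fun fun j => ?_
      have h7 : evolutionCoeff θ s c (m, j + 1) * (j + 1) * t ^ j
          = s * ((m + 1) * (m + θ)) *
            (besselWeight θ (m + 1) j / j.factorial * (s * t) ^ j * c (m + 1 + j)) := by
        rw [evolutionCoeff, besselWeight_succ', Nat.factorial_succ, mul_pow,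
          show m + 1 + j = m + (j + 1) by ring]
        push_cast
        field_simp
        ring
      have h8 : deriv (fun w : ℂ => (evolutionCoeff θ s c (m, j + 1) : ℂ) * w ^ (j + 1) * z ^ m) t
          = ((evolutionCoeff θ s c (m, j + 1) * (j + 1) * t ^ j : ℝ) : ℂ) * z ^ m := by
        rw [(((hasDerivAt_pow (j + 1) (t : ℂ)).const_mul _).mul_const (z ^ m)).deriv]
        push_cast
        ring_nf
      rw [h8, h7]
      push_cast
      ring
    have h9 := h3.prod_fiberwise hrow
    rw [← tsum_mul_left]
    exact h9.tsum_eq.symm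
  · obtain ⟨m, j⟩ := x
    rcases j with _ | j
    · simp
    · exact absurd ⟨(m, j), rfl⟩ hx

end TimeEvolution

/-! ### The operator `Δ + d / (x, x) (x, ∇)` on entire radial functions; existence -/

section Laplacian

variable {N : ℕ}

theorem hasFDerivAt_comp_norm_sq {q : ℝ → ℂ} {q1 : ℂ} (x : Space N)
    (hq : HasDerivAt q q1 (‖x‖ ^ 2)) :
    HasFDerivAt (fun y : Space N => q (‖y‖ ^ 2))
      (ContinuousLinearMap.smulRight ((2 : ℝ) • innerSL ℝ x) q1) x := by
  have h1 := hq.hasFDerivAt.comp x (hasStrictFDerivAt_norm_sq x).hasFDerivAt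
  refine h1.congr_fderiv ?_
  ext v
  simp [mul_assoc]

theorem fderiv_radial {F : Space N → ℂ} {q : ℝ → ℂ} {q1 : ℂ} {x : Space N}
    (hF : F =ᶠ[𝓝 x] fun y => q (‖y‖ ^ 2)) (hq : HasDerivAt q q1 (‖x‖ ^ 2)) :
    fderiv ℝ F x x = ((2 * ‖x‖ ^ 2 : ℝ) : ℂ) * q1 := by
  rw [hF.fderiv_eq, (hasFDerivAt_comp_norm_sq x hq).fderiv]
  simp

/-- `Δ (q (|x| ^ 2)) = 4 z q'' (z) + 2 N q' (z)` at `z = |x| ^ 2`. -/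
theorem laplacian_radial {F : Space N → ℂ} {q q1 : ℝ → ℂ} {q2 : ℂ} {x : Space N}
    (hF : F =ᶠ[𝓝 x] fun y => q (‖y‖ ^ 2)) (hq : ∀ᶠ z in 𝓝 (‖x‖ ^ 2), HasDerivAt q (q1 z) z)
    (hq1 : HasDerivAt q1 q2 (‖x‖ ^ 2)) :
    Laplacian.laplacian F x = ((4 * ‖x‖ ^ 2 : ℝ) : ℂ) * q2 + ((2 * N : ℝ) : ℂ) * q1 (‖x‖ ^ 2) := by
  have hcont : Tendsto (fun y : Space N => ‖y‖ ^ 2) (𝓝 x) (𝓝 (‖x‖ ^ 2)) :=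
    (by fun_prop : Continuous fun y : Space N => ‖y‖ ^ 2).tendsto x
  have hD : fderiv ℝ F =ᶠ[𝓝 x]
      fun y => ContinuousLinearMap.smulRightL ℝ (Space N) ℂ ((2 : ℝ) • innerSL ℝ y)
        (q1 (‖y‖ ^ 2)) := by
    filter_upwards [hF.eventuallyEq_nhds, hcont.eventually hq] with y hy hqy
    rw [hy.fderiv_eq, (hasFDerivAt_comp_norm_sq y hqy).fderiv]
    rfl
  have hD1 : HasFDerivAt (fun y : Space N => q1 (‖y‖ ^ 2)) _ x := hasFDerivAt_comp_norm_sq x hq1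
  have hD2 : HasFDerivAt (fun y : Space N => (2 : ℝ) • innerSL ℝ y) ((2 : ℝ) • innerSL ℝ) x :=
    ((2 : ℝ) • innerSL ℝ : Space N →L[ℝ] Space N →L[ℝ] ℝ).hasFDerivAt
  have hB := (ContinuousLinearMap.smulRightL ℝ (Space N) ℂ).hasFDerivAt_of_bilinear hD2 hD1
  rw [InnerProductSpace.laplacian_eq_iteratedFDeriv_orthonormalBasis F
    (EuclideanSpace.basisFun (Fin N) ℝ)]
  have hterm : ∀ i : Fin N, iteratedFDeriv ℝ 2 F x
      ![EuclideanSpace.basisFun (Fin N) ℝ i, EuclideanSpace.basisFun (Fin N) ℝ i]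
      = ((4 * x i ^ 2 : ℝ) : ℂ) * q2 + 2 * q1 (‖x‖ ^ 2) := fun i => by
    rw [iteratedFDeriv_two_apply, hD.fderiv_eq, hB.fderiv]
    simp only [EuclideanSpace.basisFun_apply, add_apply, Matrix.cons_val_zero, Matrix.cons_val_one]
    have h1 : (innerSL ℝ (EuclideanSpace.single i (1 : ℝ) : Space N)) (EuclideanSpace.single i 1)
        = 1 := by
      rw [innerSL_apply_apply]
      simp
    simp [EuclideanSpace.inner_single_right]
    erw [h1]
    push_cast
    ring
  simp only [hterm]
  rw [Finset.sum_add_distrib, ← Finset.sum_mul, ← Complex.ofReal_sum, ← Finset.mul_sum,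
    EuclideanSpace.real_norm_sq_eq]
  simp
  ring

theorem radialOpAway_radial {d : ℝ} {F : Space N → ℂ} {q q1 : ℝ → ℂ} {q2 : ℂ} {x : Space N}
    (hx : x ≠ 0) (hF : F =ᶠ[𝓝 x] fun y => q (‖y‖ ^ 2))
    (hq : ∀ᶠ z in 𝓝 (‖x‖ ^ 2), HasDerivAt q (q1 z) z) (hq1 : HasDerivAt q1 q2 (‖x‖ ^ 2)) :
    radialOpAway d F x
      = 4 * (((‖x‖ ^ 2 : ℝ) : ℂ) * q2 + (((N + d) / 2 : ℝ) : ℂ) * q1 (‖x‖ ^ 2)) := by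
  have h : ((‖x‖ : ℝ) : ℂ) ≠ 0 := by exact_mod_cast norm_ne_zero_iff.mpr hx
  rw [radialOpAway, laplacian_radial hF hq hq1, fderiv_radial hF hq.self_of_nhds,
    real_inner_self_eq_norm_sq]
  push_cast
  field_simp
  ring

/-- On `f ((x, x))` the operator acts as `4 (z f'' + θ f')`, `θ = (N + d) / 2`, also at the
origin. -/
theorem radialOp_entire (hN : 1 ≤ N) (d : ℝ) {f : ℂ → ℂ} (hf : Differentiable ℂ f) (x : Space N) :
    radialOp d (fun y : Space N => f ((inner ℝ y y : ℝ) : ℂ)) x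
      = 4 * (((‖x‖ ^ 2 : ℝ) : ℂ) * deriv (deriv f) ((‖x‖ ^ 2 : ℝ) : ℂ)
        + (((N + d) / 2 : ℝ) : ℂ) * deriv f ((‖x‖ ^ 2 : ℝ) : ℂ)) := by
  have hf1 : Differentiable ℂ (deriv f) :=
    fun z => (hf.analyticAt z).deriv.differentiableAt
  have hf2 : Continuous (deriv (deriv f)) := continuous_iff_continuousAt.mpr
    fun z => ((hf1.analyticAt z).deriv).continuousAt
  have haway : ∀ y : Space N, y ≠ 0 →
      radialOpAway d (fun y : Space N => f ((inner ℝ y y : ℝ) : ℂ)) y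
      = 4 * (((‖y‖ ^ 2 : ℝ) : ℂ) * deriv (deriv f) ((‖y‖ ^ 2 : ℝ) : ℂ)
        + (((N + d) / 2 : ℝ) : ℂ) * deriv f ((‖y‖ ^ 2 : ℝ) : ℂ)) := fun y hy =>
    radialOpAway_radial (q := fun z => f z) (q1 := fun z => deriv f z) hy
      (Eventually.of_forall fun w => by
        simp only [real_inner_self_eq_norm_sq])
      (Eventually.of_forall fun z => (hf z).hasDerivAt.comp_ofReal)
      ((hf1 _).hasDerivAt.comp_ofReal)
  rw [radialOp]
  split_ifs with hx
  · have : Nontrivial (Space N) := by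
      have : Nonempty (Fin N) := ⟨⟨0, hN⟩⟩
      infer_instance
    have : NeBot (𝓝[≠] (0 : Space N)) := Module.punctured_nhds_neBot ℝ (Space N) 0
    refine Tendsto.limUnder_eq ?_
    rw [hx]
    have hc : Continuous fun y : Space N => 4 * (((‖y‖ ^ 2 : ℝ) : ℂ) *
        deriv (deriv f) ((‖y‖ ^ 2 : ℝ) : ℂ)
        + (((N + d) / 2 : ℝ) : ℂ) * deriv f ((‖y‖ ^ 2 : ℝ) : ℂ)) := by
      have := hf1.continuous
      fun_prop
    refine ((hc.tendsto 0).mono_left nhdsWithin_le_nhds).congr' ?_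
    filter_upwards [self_mem_nhdsWithin] with y hy
    exact (haway y hy).symm
  · exact haway x hx

theorem isotAnalytic_of_entire {f : ℂ → ℂ} (hf : Differentiable ℂ f) :
    (fun x : Space N => f ((inner ℝ x x : ℝ) : ℂ)) ∈ isotAnalytic N := by
  refine ⟨fun x _ => ?_, fun U x => by simp only [U.inner_map_map]⟩
  have h1 : AnalyticAt ℝ (fun x : Space N => ‖x‖ ^ 2) x :=
    (contDiff_norm_sq ℝ).contDiffAt.analyticAt
  simp_rw [real_inner_self_eq_norm_sq]
  have h2 : AnalyticAt ℝ f ((‖x‖ ^ 2 : ℝ) : ℂ) := (hf.analyticAt _).restrictScalars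
  have h3 : AnalyticAt ℝ (fun x : Space N => ((‖x‖ ^ 2 : ℝ) : ℂ)) x :=
    (Complex.ofRealCLM.analyticAt _).comp h1
  exact h2.comp_of_eq h3 rfl

end Laplacian

section Existence

variable {N : ℕ}

theorem IsLaguerreSeq.differentiable {σ : ℝ} {c : ℕ → ℝ} (hc : IsLaguerreSeq σ c) :
    Differentiable ℂ (powerSum c) := fun z => by
  obtain ⟨K, -, hK⟩ := hc.exists_bound (lt_add_one σ)
  exact (hasDerivAt_powerSum hc.nonneg hK z).differentiableAt

/-- The evolution of a Laguerre power series of type `σ` solves the Cauchy problem as long as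
`4 τ σ < 1`. -/
theorem isCauchySolution_flow (hN : 1 ≤ N) {d τ σ : ℝ} (hd : -(N : ℝ) ≤ d) {c : ℕ → ℝ}
    (hc : IsLaguerreSeq σ c) (hσ : 0 ≤ σ) (hτ : 0 ≤ 4 * τ) (hτσ : 4 * τ * σ < 1) :
    IsCauchySolution τ d (fun x : Space N => powerSum c ((inner ℝ x x : ℝ) : ℂ))
      (fun t x => powerSum (flowCoeff ((N + d) / 2) (4 * τ * t) c) ((inner ℝ x x : ℝ) : ℂ)) := by
  set θ : ℝ := (N + d) / 2 with hθdef
  have hθ : 0 ≤ θ := by rw [hθdef]; linarith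
  obtain ⟨T, hT, hsum⟩ := hc.exists_summable_evolution hθ hσ hτ hτσ
  have hsum1 : ∀ R ≥ (0 : ℝ), Summable fun x : ℕ × ℕ =>
      evolutionCoeff θ (4 * τ) c x * 1 ^ x.2 * R ^ x.1 := fun R hR =>
    (hsum R hR).of_nonneg_of_le (fun x => mul_nonneg (mul_nonneg
      (evolutionCoeff_nonneg hθ hτ hc.nonneg x) (by positivity)) (by positivity)) fun x => by
        have := evolutionCoeff_nonneg (θ := θ) (s := 4 * τ) hθ hτ hc.nonneg x
        gcongr
  have hev : ∀ t ∈ Icc (0 : ℝ) 1, ∀ z : ℂ,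
      evolution θ (4 * τ) c t z = powerSum (flowCoeff θ (4 * τ * t) c) z := fun t ht z =>
    evolution_eq_powerSum hθ hτ hc.nonneg hsum1 ht z
  have hflow : ∀ t ∈ Icc (0 : ℝ) 1,
      IsLaguerreSeq (σ / (1 - 4 * τ * t * σ)) (flowCoeff θ (4 * τ * t) c) := fun t ht =>
    hc.flow hθ hσ (mul_nonneg hτ ht.1) (by
      have := mul_le_mul_of_nonneg_left ht.2 (mul_nonneg hτ hσ)
      linarith)
  refine ⟨?_, fun t ht => isotAnalytic_of_entire (hflow t ht).differentiable, ?_, ?_, ?_⟩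
  · have hcont : ∀ R ≥ 0, ContinuousOn (fun p : ℝ × Space N =>
        evolution θ (4 * τ) c p.1 ((inner ℝ p.2 p.2 : ℝ) : ℂ))
        (Icc (0 : ℝ) 1 ×ˢ Metric.ball 0 R) := fun R hR => by
      refine continuousOn_tsum (u := fun x : ℕ × ℕ =>
        evolutionCoeff θ (4 * τ) c x * 1 ^ x.2 * (R ^ 2) ^ x.1) (fun x => by fun_prop)
        (hsum1 _ (by positivity)) fun x p hp => ?_
      refine norm_evolution_term_le hθ hτ hc.nonneg ?_ ?_ x
      · simpa [abs_of_nonneg hp.1.1] using hp.1.2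
      · rw [real_inner_self_eq_norm_sq, Complex.norm_real, Real.norm_of_nonneg (by positivity)]
        have : ‖p.2‖ < R := by simpa using hp.2
        gcongr
    refine continuousOn_of_locally_continuousOn fun p hp => ?_
    refine ⟨univ ×ˢ Metric.ball 0 (‖p.2‖ + 1), isOpen_univ.prod Metric.isOpen_ball, by simp, ?_⟩
    refine ((hcont (‖p.2‖ + 1) (by positivity)).congr fun p' hp' => ?_).mono fun p' hp' =>
      ⟨hp'.1.1, hp'.2.2⟩
    exact (hev p'.1 hp'.1 _).symm
  · have h1 := hflow 1 ⟨zero_le_one, le_rfl⟩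
    obtain ⟨K, hK, hKb⟩ := h1.exists_bound (lt_add_one _)
    refine ⟨K, σ / (1 - 4 * τ * 1 * σ) + 1, fun t ht x => ?_⟩
    have h2 := norm_powerSum_le (hflow t ht).nonneg (fun k => (flowCoeff_mono hθ hc.nonneg
      (mul_nonneg hτ ht.1) (mul_le_mul_of_nonneg_left ht.2 hτ)
      (hc.summable_flowCoeff hθ hσ (by simpa using hτ) (by simpa using hτσ) k)).trans (hKb k))
      ((inner ℝ x x : ℝ) : ℂ)
    rw [Complex.norm_real, real_inner_self_eq_norm_sq, Real.norm_of_nonneg (by positivity)] at h2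
    simpa only [real_inner_self_eq_norm_sq] using h2
  · intro t ht x
    rw [radialOp_entire hN d (hflow t ht).differentiable x, ← hθdef]
    have h1 := (hc.hasDerivAt_evolution hθ hσ hτ hτσ ht
      ((inner ℝ x x : ℝ) : ℂ)).comp_ofReal.hasDerivWithinAt (s := Icc (0 : ℝ) 1)
    refine (h1.congr_of_mem (fun t' ht' => (hev t' ht' _).symm) ht).congr_deriv ?_
    rw [real_inner_self_eq_norm_sq]
    push_cast
    ring
  · intro x
    simp only [mul_zero, flowCoeff_zero]

end Existence

/-! ### A maximum principle for the radial heat equation -/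

section MaximumPrinciple

theorem deriv_deriv_nonpos_of_isLocalMax {v : ℝ → ℝ} {r : ℝ} (hc : ContinuousAt v r)
    (h : IsLocalMax v r) : deriv (deriv v) r ≤ 0 := by
  by_contra! hpos
  have hmin := isLocalMin_of_deriv_deriv_pos hpos h.deriv_eq_zero hc
  have hconst : v =ᶠ[𝓝 r] fun _ => v r := by
    filter_upwards [h, hmin] with x h1 h2 using le_antisymm h1 h2
  have h1 : deriv v =ᶠ[𝓝 r] fun _ => 0 := by
    filter_upwards [hconst.eventuallyEq_nhds] with x hx
    rw [hx.deriv_eq, deriv_const]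
  rw [h1.deriv_eq, deriv_const] at hpos
  exact lt_irrefl _ hpos

theorem nonneg_of_hasDerivWithinAt_Icc_right {f : ℝ → ℝ} {f' a b : ℝ} (hab : a < b)
    (hf : HasDerivWithinAt f f' (Icc a b) b) (hmax : ∀ s ∈ Icc a b, f s ≤ f b) : 0 ≤ f' := by
  have h1 : IsLocalMaxOn f (Icc a b) b := eventually_of_mem self_mem_nhdsWithin hmax
  have h2 := h1.hasFDerivWithinAt_nonpos hf.hasFDerivWithinAt
    (sub_mem_posTangentConeAt_of_segment_subset
      (by rw [segment_symm, segment_eq_Icc hab.le]) : a - b ∈ posTangentConeAt (Icc a b) b)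
  simp at h2
  nlinarith

/-- The radial part `v'' + (κ / r) v'` of the operator on even functions of `r`, continued to
`r = 0` by `(κ + 1) v'' (0)`. -/
noncomputable def radialPart {E : Type*} [NormedAddCommGroup E] [NormedSpace ℝ E] (κ : ℝ)
    (v : ℝ → E) (r : ℝ) : E :=
  if r = 0 then (κ + 1) • deriv (deriv v) 0 else deriv (deriv v) r + (κ / r) • deriv v r

theorem radialPart_sub {E : Type*} [NormedAddCommGroup E] [NormedSpace ℝ E] (κ : ℝ)
    {v w : ℝ → E} (hv : ContDiff ℝ 2 v) (hw : ContDiff ℝ 2 w) (r : ℝ) :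
    radialPart κ (fun x => v x - w x) r = radialPart κ v r - radialPart κ w r := by
  have h1 : deriv (fun x => v x - w x) = fun x => deriv v x - deriv w x := funext fun x =>
    deriv_fun_sub (hv.differentiable two_ne_zero x) (hw.differentiable two_ne_zero x)
  have h2 : ∀ x, deriv (fun x => deriv v x - deriv w x) x
      = deriv (deriv v) x - deriv (deriv w) x := fun x =>
    deriv_fun_sub ((hv.differentiable_deriv_two) x) ((hw.differentiable_deriv_two) x)
  simp only [radialPart, h1, h2]
  split_ifs <;> module

theorem radialPart_clm {E F : Type*} [NormedAddCommGroup E] [NormedSpace ℝ E]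
    [NormedAddCommGroup F] [NormedSpace ℝ F] (L : E →L[ℝ] F) (κ : ℝ)
    {v : ℝ → E} (hv : ContDiff ℝ 2 v) (r : ℝ) :
    radialPart κ (fun x => L (v x)) r = L (radialPart κ v r) := by
  have h1 : deriv (fun x => L (v x)) = fun x => L (deriv v x) := funext fun x =>
    (L.hasFDerivAt.comp_hasDerivAt x (hv.differentiable two_ne_zero x).hasDerivAt).deriv
  have h2 : ∀ x, deriv (fun x => L (deriv v x)) x = L (deriv (deriv v) x) := fun x =>
    (L.hasFDerivAt.comp_hasDerivAt x (hv.differentiable_deriv_two x).hasDerivAt).deriv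
  simp only [radialPart, h1, h2]
  split_ifs <;> simp

theorem radialPart_nonpos_of_isLocalMax {κ : ℝ} (hκ : -1 ≤ κ) {v : ℝ → ℝ} {r : ℝ}
    (hc : ContinuousAt v r) (h : IsLocalMax v r) : radialPart κ v r ≤ 0 := by
  have h2 := deriv_deriv_nonpos_of_isLocalMax hc h
  rw [radialPart]
  split_ifs with hr
  · rw [hr] at h2
    exact mul_nonpos_of_nonneg_of_nonpos (by linarith) h2
  · simpa [h.deriv_eq_zero] using h2

theorem radialPart_gaussian (κ ε c k r : ℝ) :
    radialPart κ (fun x => ε * Real.exp (c * x ^ 2 + k)) r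
      = (2 * c * (1 + κ) + 4 * c ^ 2 * r ^ 2) * (ε * Real.exp (c * r ^ 2 + k)) := by
  have h1 : deriv (fun x => ε * Real.exp (c * x ^ 2 + k))
      = fun x => ε * (Real.exp (c * x ^ 2 + k) * (c * (2 * x))) := funext fun x => by
    have h := ((((hasDerivAt_pow 2 x).const_mul c).add_const k).exp).const_mul ε
    simpa using h.deriv
  have h2 : ∀ x, deriv (fun x => ε * (Real.exp (c * x ^ 2 + k) * (c * (2 * x)))) x
      = (2 * c + 4 * c ^ 2 * x ^ 2) * (ε * Real.exp (c * x ^ 2 + k)) := fun x => by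
    have h := (((((hasDerivAt_pow 2 x).const_mul c).add_const k).exp).mul
      (((hasDerivAt_id x).const_mul 2).const_mul c)).const_mul ε
    refine h.deriv.trans ?_
    simp
    ring
  rw [radialPart, h1]
  simp only [h2]
  split_ifs with hr
  · rw [hr]; simp; ring
  · simp only [smul_eq_mul]
    field_simp
    ring

/-- Maximum principle of Tychonoff type on a short time interval: the solution is compared with
the strict supersolution `ε exp (c (t) r ^ 2 + k t)`, where `c' = 16 τ c₀ ^ 2 ≥ 4 τ c ^ 2` as long
as `c ≤ 2 c₀`. -/
theorem nonpos_of_short_time {κ τ K b t₀ t₁ : ℝ} (hκ : -1 ≤ κ) (hτ : 0 ≤ τ) (hb : 0 ≤ b)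
    (hshort : 16 * τ * (b + 1) * (t₁ - t₀) ≤ 1) {w : ℝ → ℝ → ℝ}
    (hcont : ContinuousOn (fun p : ℝ × ℝ => w p.1 p.2) (Icc t₀ t₁ ×ˢ univ))
    (hsmooth : ∀ t ∈ Icc t₀ t₁, ContDiff ℝ 2 (w t))
    (heq : ∀ t ∈ Icc t₀ t₁, ∀ r,
      HasDerivWithinAt (fun s => w s r) (τ * radialPart κ (w t) r) (Icc t₀ t₁) t)
    (hgrowth : ∀ t ∈ Icc t₀ t₁, ∀ r, w t r ≤ K * Real.exp (b * r ^ 2))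
    (hinit : ∀ r, w t₀ r ≤ 0) : ∀ t ∈ Icc t₀ t₁, ∀ r, w t r ≤ 0 := by
  intro t ht r
  by_contra! hpos
  set c₀ := b + 1 with hc₀
  have hc₀pos : 0 < c₀ := by linarith
  set c : ℝ → ℝ := fun s => c₀ + 16 * τ * c₀ ^ 2 * (s - t₀) with hc
  set k := 4 * τ * c₀ * (1 + κ) + 1 with hk
  have hkpos : 0 < k := by
    have : 0 ≤ 4 * τ * c₀ * (1 + κ) :=
      mul_nonneg (by positivity) (by linarith)
    linarith
  have hc1 : ∀ s ∈ Icc t₀ t₁, c₀ ≤ c s := fun s hs => by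
    have := mul_nonneg (by positivity : 0 ≤ 16 * τ * c₀ ^ 2) (sub_nonneg.mpr hs.1)
    simp only [hc]; linarith
  have hc2 : ∀ s ∈ Icc t₀ t₁, c s ≤ 2 * c₀ := fun s hs => by
    have h1 : 16 * τ * c₀ ^ 2 * (s - t₀) ≤ c₀ * (16 * τ * c₀ * (t₁ - t₀)) := by
      have := mul_le_mul_of_nonneg_left (sub_le_sub_right hs.2 t₀)
        (by positivity : 0 ≤ 16 * τ * c₀ ^ 2)
      linarith
    have := mul_le_mul_of_nonneg_left hshort hc₀pos.le
    simp only [hc]; linarith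
  set φ : ℝ → ℝ → ℝ := fun s x => Real.exp (c s * x ^ 2 + k * (s - t₀)) with hφ
  have hφpos : ∀ s x, 0 < φ s x := fun s x => Real.exp_pos _
  set ε := w t r / (2 * φ t r) with hε
  have hεpos : 0 < ε := div_pos hpos (by have := hφpos t r; positivity)
  -- `w - ε φ` is positive at `(t, r)` and negative for `|x| = R`, as `c ≥ c₀ = b + 1`
  obtain ⟨R, hRK, hRr⟩ : ∃ R : ℝ, K < ε * Real.exp (R ^ 2) ∧ |r| < R := by
    have h1 : Tendsto (fun R : ℝ => ε * Real.exp (R ^ 2)) atTop atTop :=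
      (Real.tendsto_exp_atTop.comp (tendsto_pow_atTop two_ne_zero)).const_mul_atTop hεpos
    obtain ⟨R, h2, h3⟩ := ((h1.eventually_gt_atTop K).and (eventually_gt_atTop |r|)).exists
    exact ⟨R, h2, h3⟩
  set v : ℝ → ℝ → ℝ := fun s x => w s x - ε * φ s x with hv
  have hvt : 0 < v t r := by
    have h1 := hφpos t r
    have h2 : ε * φ t r = w t r / 2 := by rw [hε]; field_simp
    simp only [hv, h2]; linarith
  have hvcont : ContinuousOn (fun p : ℝ × ℝ => v p.1 p.2) (Icc t₀ t₁ ×ˢ Icc (-R) R) := by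
    refine (hcont.mono (prod_mono_right (subset_univ _))).sub ?_
    simp only [hφ, hc]
    fun_prop
  obtain ⟨⟨s, x⟩, ⟨hs, hx⟩, hmax⟩ := (isCompact_Icc.prod isCompact_Icc).exists_isMaxOn
    ⟨(t, r), ht, abs_le.mp hRr.le⟩ hvcont
  have hmax' : ∀ s' ∈ Icc t₀ t₁, ∀ x' ∈ Icc (-R) R, v s' x' ≤ v s x := fun s' hs' x' hx' =>
    hmax (show (s', x') ∈ _ from ⟨hs', hx'⟩)
  have hvpos : 0 < v s x := hvt.trans_le (hmax' t ht r (abs_le.mp hRr.le))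
  simp only at hs hx
  have hst : t₀ < s := by
    refine lt_of_le_of_ne hs.1 fun h => ?_
    have h1 := hinit x
    have h2 := mul_pos hεpos (hφpos s x)
    rw [h] at h1
    simp only [hv] at hvpos
    linarith
  have hxR : x ^ 2 < R ^ 2 := by
    refine lt_of_le_of_ne (sq_le_sq' hx.1 hx.2) fun h => ?_
    have h1 := hgrowth s hs x
    have h2 : K * Real.exp (b * x ^ 2) < ε * φ s x := by
      calc K * Real.exp (b * x ^ 2) < ε * Real.exp (R ^ 2) * Real.exp (b * x ^ 2) :=
            mul_lt_mul_of_pos_right hRK (Real.exp_pos _)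
        _ = ε * Real.exp (c₀ * x ^ 2) := by
            rw [mul_assoc, ← Real.exp_add, ← h, hc₀]; ring_nf
        _ ≤ ε * φ s x := by
            refine mul_le_mul_of_nonneg_left (Real.exp_le_exp.mpr ?_) hεpos.le
            have h3 := mul_le_mul_of_nonneg_right (hc1 s hs) (sq_nonneg x)
            have h4 := mul_nonneg hkpos.le (sub_nonneg.mpr hs.1)
            linarith
    simp only [hv] at hvpos
    linarith
  have hxR' := abs_lt_of_sq_lt_sq hxR ((abs_nonneg r).trans hRr.le)
  rw [abs_lt] at hxR'
  have hloc : IsLocalMax (v s) x := by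
    filter_upwards [Icc_mem_nhds hxR'.1 hxR'.2] with x' hx' using hmax' s hs x' hx'
  have hφsmooth : ContDiff ℝ 2 (fun y => ε * φ s y) := by
    simp only [hφ]
    fun_prop
  have hvs : ContDiff ℝ 2 (v s) := (hsmooth s hs).sub hφsmooth
  have hspace := radialPart_nonpos_of_isLocalMax hκ hvs.continuous.continuousAt hloc
  rw [show v s = fun y => w s y - ε * φ s y from rfl,
    radialPart_sub κ (hsmooth s hs) hφsmooth] at hspace
  have hgauss := radialPart_gaussian κ ε (c s) (k * (s - t₀)) x
  have hsub : Icc t₀ s ⊆ Icc t₀ t₁ := Icc_subset_Icc_right hs.2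
  have hφt : HasDerivWithinAt (fun s => ε * φ s x)
      (ε * (φ s x * (16 * τ * c₀ ^ 2 * x ^ 2 + k))) (Icc t₀ s) s := by
    have h1 : HasDerivAt (fun s => c s * x ^ 2 + k * (s - t₀))
        (16 * τ * c₀ ^ 2 * x ^ 2 + k) s := by
      have h2 := (((((hasDerivAt_id s).sub_const t₀).const_mul (16 * τ * c₀ ^ 2)).const_add
        c₀).mul_const (x ^ 2)).add (((hasDerivAt_id s).sub_const t₀).const_mul k)
      exact h2.congr_deriv (by simp)
    exact (h1.exp.const_mul ε).hasDerivWithinAt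
  have htime := nonneg_of_hasDerivWithinAt_Icc_right hst
    (((heq s hs x).mono hsub).sub hφt) fun s' hs' => hmax' s' (hsub hs') x hx
  -- the barrier is a strict supersolution
  have hstrict : τ * radialPart κ (fun y => ε * φ s y) x
      < ε * (φ s x * (16 * τ * c₀ ^ 2 * x ^ 2 + k)) := by
    have h1 : radialPart κ (fun y => ε * φ s y) x
        = (2 * c s * (1 + κ) + 4 * c s ^ 2 * x ^ 2) * (ε * φ s x) := hgauss
    rw [h1]
    have h2 : τ * (2 * c s * (1 + κ) + 4 * c s ^ 2 * x ^ 2) < 16 * τ * c₀ ^ 2 * x ^ 2 + k := by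
      have h3 : τ * (1 + κ) * c s ≤ τ * (1 + κ) * (2 * c₀) :=
        mul_le_mul_of_nonneg_left (hc2 s hs) (mul_nonneg hτ (by linarith))
      have h4 : c s ^ 2 ≤ (2 * c₀) ^ 2 :=
        pow_le_pow_left₀ (hc₀pos.le.trans (hc1 s hs)) (hc2 s hs) 2
      have h5 : τ * x ^ 2 * c s ^ 2 ≤ τ * x ^ 2 * (2 * c₀) ^ 2 :=
        mul_le_mul_of_nonneg_left h4 (by positivity)
      rw [hk]
      nlinarith
    have h6 := mul_lt_mul_of_pos_right h2 (mul_pos hεpos (hφpos s x))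
    linarith
  have := mul_nonpos_of_nonneg_of_nonpos hτ hspace
  linarith

/-- Maximum principle on `[0, 1]`, by finitely many short time steps. -/
theorem nonpos_of_radial_heat {κ τ K b : ℝ} (hκ : -1 ≤ κ) (hτ : 0 ≤ τ) (hb : 0 ≤ b)
    {w : ℝ → ℝ → ℝ}
    (hcont : ContinuousOn (fun p : ℝ × ℝ => w p.1 p.2) (Icc 0 1 ×ˢ univ))
    (hsmooth : ∀ t ∈ Icc (0 : ℝ) 1, ContDiff ℝ 2 (w t))
    (heq : ∀ t ∈ Icc (0 : ℝ) 1, ∀ r,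
      HasDerivWithinAt (fun s => w s r) (τ * radialPart κ (w t) r) (Icc 0 1) t)
    (hgrowth : ∀ t ∈ Icc (0 : ℝ) 1, ∀ r, w t r ≤ K * Real.exp (b * r ^ 2))
    (hinit : ∀ r, w 0 r ≤ 0) : ∀ t ∈ Icc (0 : ℝ) 1, ∀ r, w t r ≤ 0 := by
  obtain ⟨M, hM⟩ := exists_nat_gt (16 * τ * (b + 1))
  have hM0 : (0 : ℝ) < M := lt_of_le_of_lt (by positivity) hM
  have key : ∀ i : ℕ, i ≤ M → ∀ t ∈ Icc (0 : ℝ) (i / M), ∀ r, w t r ≤ 0 := by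
    intro i
    induction i with
    | zero =>
      intro _ t ht r
      have : t = 0 := le_antisymm (by simpa using ht.2) ht.1
      rw [this]
      exact hinit r
    | succ i ih =>
      intro hi t ht r
      have ih' := ih (by omega)
      rcases le_total t (i / M) with h | h
      · exact ih' t ⟨ht.1, h⟩ r
      · have h0 : (0 : ℝ) ≤ i / M := by positivity
        have h1 : ((i + 1 : ℕ) : ℝ) / M ≤ 1 := by
          rw [div_le_one hM0]
          exact_mod_cast hi
        have hsub : Icc ((i : ℝ) / M) ((i + 1 : ℕ) / M) ⊆ Icc 0 1 := Icc_subset_Icc h0 h1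
        refine nonpos_of_short_time hκ hτ hb ?_ (hcont.mono (prod_mono_left hsub))
          (fun s hs => hsmooth s (hsub hs)) (fun s hs x => (heq s (hsub hs) x).mono hsub)
          (fun s hs x => hgrowth s (hsub hs) x) (fun x => ih' _ ⟨h0, le_rfl⟩ x) t ⟨h, ht.2⟩ r
        rw [← sub_div]
        push_cast
        rw [add_sub_cancel_left, mul_one_div, div_le_one hM0]
        exact hM.le
  intro t ht r
  exact key M le_rfl t ⟨ht.1, by rw [div_self hM0.ne']; exact ht.2⟩ r

end MaximumPrinciple

/-! ### Uniqueness -/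

section Uniqueness

variable {N : ℕ}

theorem exists_isometry_map (y z : Space N) (h : ‖y‖ = ‖z‖) :
    ∃ U : Space N ≃ₗᵢ[ℝ] Space N, U y = z :=
  ⟨(ℝ ∙ (y - z))ᗮ.reflection, Submodule.reflection_sub h⟩

theorem eq_of_norm_eq {F : Space N → ℂ} (hF : F ∈ isotAnalytic N) {y z : Space N}
    (h : ‖y‖ = ‖z‖) : F y = F z := by
  obtain ⟨U, hU⟩ := exists_isometry_map y z h
  rw [← hU, hF.2]

theorem contDiff_profile {F : Space N → ℂ} (hF : F ∈ isotAnalytic N) (e : Space N) :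
    ContDiff ℝ 2 fun r : ℝ => F (r • e) := by
  have h : ContDiff ℝ 2 F := contDiff_iff_contDiffAt.mpr fun x => (hF.1 x (mem_univ x)).contDiffAt
  exact h.comp (contDiff_id.smul contDiff_const)

theorem deriv_neg_of_even {h : ℝ → ℂ} (heven : ∀ r, h (-r) = h r) (r : ℝ) :
    deriv h (-r) = -deriv h r := by
  have h1 := deriv_comp_neg h r
  simp only [heven] at h1
  rw [h1, neg_neg]

theorem deriv_deriv_neg_of_even {h : ℝ → ℂ} (heven : ∀ r, h (-r) = h r) (r : ℝ) :
    deriv (deriv h) (-r) = deriv (deriv h) r := by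
  have h1 := deriv_comp_neg (deriv h) r
  simp only [deriv_neg_of_even heven, deriv.fun_neg] at h1
  exact (neg_inj.mp h1).symm

/-- Away from the origin the operator acts on the profile `r ↦ F (r e)` of an isotropic function,
`|e| = 1`, as `h'' + ((N - 1 + d) / r) h'`: near a point of norm `ρ` one has
`F = q (|x| ^ 2)` with `q (z) = h (√z)`. -/
theorem radialOpAway_profile (d : ℝ) {F : Space N → ℂ} (hF : F ∈ isotAnalytic N) {e : Space N}
    (he : ‖e‖ = 1) {x : Space N} (hx : x ≠ 0) :
    radialOpAway d F x = radialPart (N - 1 + d) (fun r : ℝ => F (r • e)) ‖x‖ := by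
  set h : ℝ → ℂ := fun r => F (r • e) with hh
  have hsm : ContDiff ℝ 2 h := contDiff_profile hF e
  have hρ : 0 < ‖x‖ := norm_pos_iff.mpr hx
  have hFq : F =ᶠ[𝓝 x] fun y => h (Real.sqrt (‖y‖ ^ 2)) := Eventually.of_forall fun y => by
    simp only [hh]
    refine eq_of_norm_eq hF ?_
    rw [norm_smul, he, mul_one, Real.sqrt_sq (norm_nonneg y), norm_norm]
  have hq : ∀ z : ℝ, 0 < z → HasDerivAt (fun z => h (Real.sqrt z))
      ((1 / (2 * Real.sqrt z)) • deriv h (Real.sqrt z)) z := fun z hz =>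
    (hsm.differentiable two_ne_zero _).hasDerivAt.scomp z (Real.hasDerivAt_sqrt hz.ne')
  have hsqrt : Real.sqrt (‖x‖ ^ 2) = ‖x‖ := Real.sqrt_sq hρ.le
  have hq1 : HasDerivAt (fun z => (1 / (2 * Real.sqrt z)) • deriv h (Real.sqrt z))
      ((1 / (4 * ‖x‖ ^ 2)) • deriv (deriv h) ‖x‖ - (1 / (4 * ‖x‖ ^ 3)) • deriv h ‖x‖)
      (‖x‖ ^ 2) := by
    have hz : ‖x‖ ^ 2 ≠ 0 := (pow_pos hρ 2).ne'
    have h1 := Real.hasDerivAt_sqrt hz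
    have h2 := (h1.const_mul 2).fun_inv (by rw [hsqrt]; positivity)
    have h3 := (hsm.differentiable_deriv_two (Real.sqrt (‖x‖ ^ 2))).hasDerivAt.scomp _ h1
    have h4 := h2.fun_smul h3
    simp only [one_div]
    refine h4.congr_deriv ?_
    simp only [Function.comp, hsqrt]
    rw [smul_smul, sub_eq_add_neg, ← neg_smul]
    congr 2
    · field_simp; norm_num
    · field_simp; norm_num
  rw [radialOpAway_radial (q := fun z => h (Real.sqrt z)) hx hFq
    ((lt_mem_nhds (pow_pos hρ 2)).mono hq) hq1, radialPart, if_neg hρ.ne']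
  simp only [hsqrt, Complex.real_smul]
  have hρ' : ((‖x‖ : ℝ) : ℂ) ≠ 0 := by exact_mod_cast hρ.ne'
  push_cast
  field_simp
  ring

/-- The operator in terms of the profile, also at the origin. -/
theorem radialOp_profile (d : ℝ) {F : Space N → ℂ} (hF : F ∈ isotAnalytic N) {e : Space N}
    (he : ‖e‖ = 1) (r : ℝ) :
    radialOp d F (r • e) = radialPart (N - 1 + d) (fun r : ℝ => F (r • e)) r := by
  set h : ℝ → ℂ := fun r => F (r • e) with hh
  have hsm : ContDiff ℝ 2 h := contDiff_profile hF e
  have heven : ∀ r, h (-r) = h r := fun r => eq_of_norm_eq hF (by simp)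
  have he0 : e ≠ 0 := fun h0 => by simp [h0] at he
  rcases eq_or_ne r 0 with rfl | hr
  · rw [zero_smul, radialOp, if_pos rfl, radialPart, if_pos rfl]
    have : Nontrivial (Space N) := ⟨e, 0, he0⟩
    have : NeBot (𝓝[≠] (0 : Space N)) := Module.punctured_nhds_neBot ℝ (Space N) 0
    refine Tendsto.limUnder_eq ?_
    have hd0 : deriv h 0 = 0 := by
      have h1 := deriv_neg_of_even heven 0
      rw [neg_zero] at h1
      exact self_eq_neg.mp h1
    have hnorm : Tendsto (fun x : Space N => ‖x‖) (𝓝[≠] 0) (𝓝[≠] 0) :=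
      tendsto_nhdsWithin_iff.mpr ⟨(continuous_norm.tendsto' 0 0 norm_zero).mono_left
        nhdsWithin_le_nhds, by
          filter_upwards [self_mem_nhdsWithin] with x hx using norm_ne_zero_iff.mpr hx⟩
    have hslope : Tendsto (fun ρ : ℝ => ρ⁻¹ • deriv h ρ) (𝓝[≠] 0) (𝓝 (deriv (deriv h) 0)) := by
      have h1 := hasDerivAt_iff_tendsto_slope.mp (hsm.differentiable_deriv_two 0).hasDerivAt
      refine h1.congr fun ρ => ?_
      simp [slope, hd0]
    have hsecond : Tendsto (deriv (deriv h)) (𝓝[≠] 0) (𝓝 (deriv (deriv h) 0)) := by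
      have h1 : Continuous (deriv (deriv h)) := by
        have h2 := hsm.continuous_iteratedDeriv 2 le_rfl
        rwa [iteratedDeriv_succ, iteratedDeriv_one] at h2
      exact (h1.tendsto 0).mono_left nhdsWithin_le_nhds
    have hlim := (hsecond.add (hslope.const_smul ((N : ℝ) - 1 + d))).comp hnorm
    have hval : deriv (deriv h) 0 + ((N : ℝ) - 1 + d) • deriv (deriv h) 0
        = ((N : ℝ) - 1 + d + 1) • deriv (deriv h) 0 := by module
    rw [hval] at hlim
    refine hlim.congr' ?_
    filter_upwards [self_mem_nhdsWithin] with x hx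
    rw [radialOpAway_profile d hF he hx, radialPart, if_neg (norm_ne_zero_iff.mpr hx),
      Function.comp, smul_smul, div_eq_mul_inv]
  · have hx : r • e ≠ 0 := smul_ne_zero hr he0
    rw [radialOp, if_neg hx, radialOpAway_profile d hF he hx, norm_smul, he, mul_one,
      Real.norm_eq_abs, ← hh]
    rcases abs_choice r with hr' | hr'
    · rw [hr']
    · rw [hr', radialPart, radialPart, if_neg hr, if_neg (neg_ne_zero.mpr hr),
        deriv_deriv_neg_of_even heven, deriv_neg_of_even heven, div_neg, neg_smul_neg]

/-- Two solutions of the Cauchy problem coincide: real and imaginary part of their difference obey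
the maximum principle in both directions. -/
theorem IsCauchySolution.unique (hN : 1 ≤ N) {τ d : ℝ} (hτ : 0 ≤ τ) (hd : -(N : ℝ) ≤ d)
    {H : Space N → ℂ} {F F' : ℝ → Space N → ℂ} (hF : IsCauchySolution τ d H F)
    (hF' : IsCauchySolution τ d H F') {t : ℝ} (ht : t ∈ Icc (0 : ℝ) 1) : F t = F' t := by
  set e : Space N := EuclideanSpace.single ⟨0, hN⟩ 1 with he_def
  have he : ‖e‖ = 1 := by simp [he_def]
  obtain ⟨K₁, b₁, h₁⟩ := hF.growth
  obtain ⟨K₂, b₂, h₂⟩ := hF'.growth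
  have hK₁ : 0 ≤ K₁ := by
    have := (norm_nonneg _).trans (h₁ 0 ⟨le_rfl, zero_le_one⟩ 0)
    simpa using this
  have hK₂ : 0 ≤ K₂ := by
    have := (norm_nonneg _).trans (h₂ 0 ⟨le_rfl, zero_le_one⟩ 0)
    simpa using this
  set b := max 0 (max b₁ b₂) with hb
  have hdiff : ∀ s ∈ Icc (0 : ℝ) 1, ∀ r : ℝ,
      ‖F s (r • e) - F' s (r • e)‖ ≤ (K₁ + K₂) * Real.exp (b * r ^ 2) := fun s hs r => by
    have h3 := h₁ s hs (r • e)
    have h4 := h₂ s hs (r • e)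
    rw [norm_smul, he, mul_one, Real.norm_eq_abs, sq_abs] at h3 h4
    have h5 : Real.exp (b₁ * r ^ 2) ≤ Real.exp (b * r ^ 2) := by
      have : b₁ ≤ b := (le_max_left _ _).trans (le_max_right _ _)
      gcongr
    have h6 : Real.exp (b₂ * r ^ 2) ≤ Real.exp (b * r ^ 2) := by
      have : b₂ ≤ b := (le_max_right _ _).trans (le_max_right _ _)
      gcongr
    have h7 := mul_le_mul_of_nonneg_left h5 hK₁
    have h8 := mul_le_mul_of_nonneg_left h6 hK₂
    have h9 := norm_sub_le (F s (r • e)) (F' s (r • e))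
    linarith
  have key : ∀ L : ℂ →L[ℝ] ℝ, ∀ r : ℝ, L (F t (r • e) - F' t (r • e)) ≤ 0 := by
    intro L
    have hsm : ∀ s ∈ Icc (0 : ℝ) 1, ContDiff ℝ 2 fun r : ℝ => F s (r • e) - F' s (r • e) :=
      fun s hs => (contDiff_profile (hF.isot s hs) e).sub (contDiff_profile (hF'.isot s hs) e)
    refine nonpos_of_radial_heat (κ := N - 1 + d) (τ := τ) (K := ‖L‖ * (K₁ + K₂)) (b := b)
      (by linarith) hτ (le_max_left _ _)
      (w := fun s r => L (F s (r • e) - F' s (r • e))) ?_ (fun s hs => L.contDiff.comp (hsm s hs))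
      (fun s hs r => ?_) (fun s hs r => ?_) (fun r => ?_) t ht
    · have hmap : ContinuousOn (fun p : ℝ × ℝ => (p.1, p.2 • e)) (Icc (0 : ℝ) 1 ×ˢ univ) := by
        fun_prop
      have hmaps : MapsTo (fun p : ℝ × ℝ => (p.1, p.2 • e)) (Icc (0 : ℝ) 1 ×ˢ univ)
          (Icc (0 : ℝ) 1 ×ˢ univ) := fun p hp => ⟨hp.1, mem_univ _⟩
      exact L.continuous.comp_continuousOn
        ((hF.continuousOn.comp hmap hmaps).sub (hF'.continuousOn.comp hmap hmaps))
    · have h3 := (hF.equation s hs (r • e)).sub (hF'.equation s hs (r • e))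
      have h4 := L.hasFDerivAt.comp_hasDerivWithinAt s h3
      refine h4.congr_deriv ?_
      rw [radialPart_clm L _ (hsm s hs), radialPart_sub _ (contDiff_profile (hF.isot s hs) e)
        (contDiff_profile (hF'.isot s hs) e), ← radialOp_profile d (hF.isot s hs) he,
        ← radialOp_profile d (hF'.isot s hs) he, ← smul_eq_mul τ, ← map_smul, Complex.real_smul,
        mul_sub]
    · refine (Real.le_norm_self _).trans ((L.le_opNorm _).trans ?_)
      rw [mul_assoc]
      exact mul_le_mul_of_nonneg_left (hdiff s hs r) (norm_nonneg L)
    · simp only [hF.initial, hF'.initial, sub_self, map_zero, le_refl]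
  funext x
  rw [eq_of_norm_eq (hF.isot t ht) (z := ‖x‖ • e) (by simp [norm_smul, he]),
    eq_of_norm_eq (hF'.isot t ht) (z := ‖x‖ • e) (by simp [norm_smul, he]), ← sub_eq_zero]
  refine Complex.ext ?_ ?_
  · have h1 := key Complex.reCLM ‖x‖
    have h2 := key (-Complex.reCLM) ‖x‖
    simp only [neg_apply, Complex.reCLM_apply] at h1 h2
    simp only [Complex.zero_re]
    linarith
  · have h1 := key Complex.imCLM ‖x‖
    have h2 := key (-Complex.imCLM) ‖x‖
    simp only [neg_apply, Complex.imCLM_apply] at h1 h2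
    simp only [Complex.zero_im]
    linarith

end Uniqueness

/-! ### The recursion -/

section Recursion

variable {N : ℕ}

theorem IsLaguerreSeq.mono {σ σ' : ℝ} {c : ℕ → ℝ} (hc : IsLaguerreSeq σ c) (h : σ ≤ σ') :
    IsLaguerreSeq σ' c := by
  obtain ⟨p, hp, hlim, hbd⟩ := hc
  exact ⟨p, hp, hlim, fun b hb => hbd b (h.trans_lt hb)⟩

theorem IsLaguerreSeq.flow_mem_radial {σ θ a : ℝ} {c : ℕ → ℝ} (hc : IsLaguerreSeq σ c)
    (h0 : 0 < c 0) (hθ : 0 ≤ θ) (hσ : 0 ≤ σ) (ha : 0 ≤ a) (haσ : a * σ < 1) :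
    0 < flowCoeff θ a c 0 ∧
      (fun x : Space N => powerSum (flowCoeff θ a c) ((inner ℝ x x : ℝ) : ℂ))
        ∈ radial N laguerrePos := by
  have hflow := hc.flow hθ hσ ha haσ
  have hpos : 0 < flowCoeff θ a c 0 := by
    have h1 := flowCoeff_mono hθ hc.nonneg le_rfl ha (hc.summable_flowCoeff hθ hσ ha haσ 0)
    rw [flowCoeff_zero] at h1
    exact h0.trans_le h1
  exact ⟨hpos, isotAnalytic_of_entire hflow.differentiable, _, hflow.mem_laguerrePos hpos,
    fun x => rfl⟩

/-- One step of the recursion. Dilation and power turn the type `α` into `δ ^ (-lam) α`, for which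
`4 τ δ ^ (-lam) α ≤ 1 - δ ^ (-lam)` by the choice of `τ`; hence the type at time `1` is again at
most `α`. -/
theorem exists_recursion_step (hN : 1 ≤ N) {δ : ℕ} (hδ : 2 ≤ δ) {lam d τ α : ℝ}
    (hd : -(N : ℝ) ≤ d) (hα : 0 ≤ α) (hτ : 0 ≤ 4 * τ) (hτα : 4 * τ * α ≤ (δ : ℝ) ^ lam - 1)
    {c : ℕ → ℝ} (hc : IsLaguerreSeq α c) (h0 : 0 < c 0) :
    ∃ F : ℝ → Space N → ℂ,
      IsCauchySolution τ d (fun x => (powerSum c ((inner ℝ ((δ : ℝ) ^ (-(1 + lam) / 2) • x)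
        ((δ : ℝ) ^ (-(1 + lam) / 2) • x) : ℝ) : ℂ)) ^ δ) F ∧
      (∀ t ∈ Icc (0 : ℝ) 1, F t ∈ radial N laguerrePos) ∧
      ∃ c', IsLaguerreSeq α c' ∧ 0 < c' 0 ∧
        ∀ x, F 1 x = powerSum c' ((inner ℝ x x : ℝ) : ℂ) := by
  have hδ0 : (0 : ℝ) < δ := by exact_mod_cast (by omega : 0 < δ)
  set s : ℝ := (δ : ℝ) ^ (-(1 + lam)) with hs
  set q : ℝ := (δ : ℝ) ^ (-lam) with hq
  have hs0 : 0 < s := Real.rpow_pos_of_pos hδ0 _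
  have hq0 : 0 < q := Real.rpow_pos_of_pos hδ0 _
  have hδs : δ * s = q := by
    rw [hs, hq, show -lam = 1 + -(1 + lam) by ring, Real.rpow_add hδ0, Real.rpow_one]
  have hqinv : q * (δ : ℝ) ^ lam = 1 := by
    rw [hq, ← Real.rpow_add hδ0, neg_add_cancel, Real.rpow_zero]
  have hsq : ((δ : ℝ) ^ (-(1 + lam) / 2)) * ((δ : ℝ) ^ (-(1 + lam) / 2)) = s := by
    rw [← Real.rpow_add hδ0, add_halves]
  obtain ⟨c₁, hc₁, hpow⟩ := hc.exists_pow_dilate hs0 (by omega : 0 < δ)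
  rw [hδs] at hc₁
  have hc₁0 : 0 < c₁ 0 := by
    have h1 := congrFun hpow 0
    simp only [mul_zero, powerSum_zero] at h1
    have h2 : c 0 ^ δ = c₁ 0 := by exact_mod_cast h1
    rw [← h2]
    exact pow_pos h0 δ
  have hqα : 0 ≤ q * α := mul_nonneg hq0.le hα
  have hbound : 4 * τ * (q * α) ≤ 1 - q := by
    have := mul_le_mul_of_nonneg_left hτα hq0.le
    rw [mul_sub, hqinv] at this
    linarith
  have hlt : 4 * τ * (q * α) < 1 := by linarith
  set θ : ℝ := (N + d) / 2 with hθdef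
  have hθ : 0 ≤ θ := by rw [hθdef]; linarith
  have ht_lt : ∀ t ∈ Icc (0 : ℝ) 1, 4 * τ * t * (q * α) < 1 := fun t ht => by
    have := mul_le_mul_of_nonneg_left ht.2 (mul_nonneg hτ hqα)
    linarith
  refine ⟨fun t x => powerSum (flowCoeff θ (4 * τ * t) c₁) ((inner ℝ x x : ℝ) : ℂ), ?_,
    fun t ht => (hc₁.flow_mem_radial hc₁0 hθ hqα (mul_nonneg hτ ht.1) (ht_lt t ht)).2,
    flowCoeff θ (4 * τ) c₁, (hc₁.flow hθ hqα hτ hlt).mono ?_,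
    (hc₁.flow_mem_radial (N := N) hc₁0 hθ hqα hτ hlt).1, fun x => by simp only [mul_one]⟩
  · have h1 := isCauchySolution_flow hN hd hc₁ hqα hτ hlt
    rw [← hpow] at h1
    convert h1 using 4 with x
    rw [real_inner_smul_left, real_inner_smul_right, ← mul_assoc, hsq, Complex.ofReal_mul]
  · rw [div_le_iff₀ (by linarith)]
    have := mul_le_mul_of_nonneg_left (by linarith : q ≤ 1 - 4 * τ * (q * α)) hα
    linarith

theorem exists_solution_upTo (hN : 1 ≤ N) {δ : ℕ} (hδ : 2 ≤ δ) {lam d τ α : ℝ}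
    (hd : -(N : ℝ) ≤ d) (hα : 0 ≤ α) (hτ : 0 ≤ 4 * τ) (hτα : 4 * τ * α ≤ (δ : ℝ) ^ lam - 1)
    {G : Space N → ℂ} {c : ℕ → ℝ} (hc : IsLaguerreSeq α c) (h0 : 0 < c 0)
    (hG : ∀ x, G x = powerSum c ((inner ℝ x x : ℝ) : ℂ)) (n : ℕ) :
    ∃ F : ℕ → ℝ → Space N → ℂ, IsSolutionUpTo δ lam τ d G n F ∧
      (∀ k ∈ Icc 1 n, ∀ t ∈ Icc (0 : ℝ) 1, F k t ∈ radial N laguerrePos) ∧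
      ∃ c', IsLaguerreSeq α c' ∧ 0 < c' 0 ∧
        ∀ x, F n 1 x = powerSum c' ((inner ℝ x x : ℝ) : ℂ) := by
  induction n with
  | zero =>
    exact ⟨fun _ _ => G, ⟨fun _ => rfl, fun k hk => absurd (hk.1.trans hk.2) (by norm_num)⟩,
      fun k hk => absurd (hk.1.trans hk.2) (by norm_num), c, hc, h0, hG⟩
  | succ n ih =>
    obtain ⟨F, ⟨hF0, hF⟩, hrad, c', hc', h0', hFn⟩ := ih
    obtain ⟨F₁, hF₁, hrad₁, c₁, hc₁, h0₁, hF₁c⟩ :=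
      exists_recursion_step hN hδ hd hα hτ hτα hc' h0'
    have hold : ∀ k ≤ n, Function.update F (n + 1) F₁ k = F k := fun k hk =>
      Function.update_of_ne (by omega) _ _
    have hnew : Function.update F (n + 1) F₁ (n + 1) = F₁ := Function.update_self _ _ _
    refine ⟨Function.update F (n + 1) F₁, ⟨?_, fun k hk => ?_⟩, fun k hk => ?_,
      c₁, hc₁, h0₁, ?_⟩
    · rw [hold 0 (Nat.zero_le n)]
      exact hF0
    · rcases Nat.lt_or_ge n k with h | h
      · obtain rfl : k = n + 1 := le_antisymm hk.2 h
        rw [hnew, Nat.add_sub_cancel, hold n le_rfl]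
        simpa only [hFn] using hF₁
      · rw [hold k h, hold (k - 1) (by omega)]
        exact hF k ⟨hk.1, h⟩
    · rcases Nat.lt_or_ge n k with h | h
      · obtain rfl : k = n + 1 := le_antisymm hk.2 h
        rw [hnew]
        exact hrad₁
      · rw [hold k h]
        exact hrad k ⟨hk.1, h⟩
    · rw [hnew]
      exact hF₁c

theorem IsSolutionUpTo.unique (hN : 1 ≤ N) {δ : ℕ} {lam d τ : ℝ} (hτ : 0 ≤ τ)
    (hd : -(N : ℝ) ≤ d) {G : Space N → ℂ} {n : ℕ} {F F' : ℕ → ℝ → Space N → ℂ}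
    (hF : IsSolutionUpTo δ lam τ d G n F) (hF' : IsSolutionUpTo δ lam τ d G n F') :
    ∀ k ∈ Icc 1 n, ∀ t ∈ Icc (0 : ℝ) 1, F' k t = F k t := by
  have hstep : ∀ k ∈ Icc 1 n, F' (k - 1) 1 = F (k - 1) 1 →
      ∀ t ∈ Icc (0 : ℝ) 1, F' k t = F k t := fun k hk h t ht => by
    have h1 := hF'.2 k hk
    rw [h] at h1
    exact h1.unique hN hτ hd (hF.2 k hk) ht
  have hend : ∀ k ≤ n, F' k 1 = F k 1 := by
    intro k
    induction k with
    | zero => exact fun _ => funext fun x => (hF'.1 x).trans (hF.1 x).symm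
    | succ k ih =>
      exact fun hk => hstep (k + 1) ⟨by omega, hk⟩ (ih (by omega)) 1 ⟨zero_le_one, le_rfl⟩
  exact fun k hk => hstep k hk (hend (k - 1) (by have := hk.2; omega))

end Recursion

end LaguerreEvolution

theorem mainTheorem6 (N : ℕ) (hN : 1 ≤ N) (δ : ℕ) (hδ : 2 ≤ δ) (lam : ℝ) (hlam : 0 < lam)
    (d : ℝ) (hd : -(N : ℝ) ≤ d)
    (G : LaguerreEvolution.Space N → ℂ)
    (hG : G ∈ LaguerreEvolution.radial N LaguerreEvolution.laguerrePos)
    (g : ℂ → ℂ) (hg : g ∈ LaguerreEvolution.laguerrePos)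
    (hGg : ∀ x : LaguerreEvolution.Space N, G x = g ((inner ℝ x x : ℝ) : ℂ))
    (τ : ℝ) (hτ : 4 * τ ∈ LaguerreEvolution.paramInterval δ lam g)
    (n : ℕ) (hn : 1 ≤ n) :
    ∃ F : ℕ → ℝ → LaguerreEvolution.Space N → ℂ,
      LaguerreEvolution.IsSolutionUpTo δ lam τ d G n F ∧
      (∀ k ∈ Set.Icc 1 n, ∀ t ∈ Set.Icc (0 : ℝ) 1,
        F k t ∈ LaguerreEvolution.radial N LaguerreEvolution.laguerrePos) ∧
      ∀ F' : ℕ → ℝ → LaguerreEvolution.Space N → ℂ,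
        LaguerreEvolution.IsSolutionUpTo δ lam τ d G n F' →
          ∀ k ∈ Set.Icc 1 n, ∀ t ∈ Set.Icc (0 : ℝ) 1, F' k t = F k t := by
  obtain ⟨C₀, m, α, γ, hrep, hτ0, hτα⟩ := hτ
  obtain ⟨c, hc, rfl⟩ := LaguerreEvolution.exists_isLaguerreSeq_of_rep hg hrep
  have hα := hrep.alpha_nonneg
  have hbound : 4 * τ * α ≤ (δ : ℝ) ^ lam - 1 := by
    rcases hα.eq_or_lt with h | h
    · have h1 : (1 : ℝ) ≤ (δ : ℝ) ^ lam :=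
        Real.one_le_rpow (by exact_mod_cast (by omega : 1 ≤ δ)) hlam.le
      rw [← h]
      linarith
    · exact (le_div_iff₀ h).mp (hτα h)
  obtain ⟨F, hF, hrad, -⟩ := LaguerreEvolution.exists_solution_upTo hN hδ hd hα hτ0 hbound hc
    (LaguerreEvolution.coeff_zero_pos_of_powerSum hg) hGg n
  exact ⟨F, hF, hrad, fun F' hF' => hF.unique hN (by linarith) hd hF'⟩
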